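/- **Setting.** Let $n\ge 1$, $\langle z,w\rangle=\sum_j z_j\overline{w_j}$, $|z|=\langle z,z\rangle^{1/2}$ on $\mathbb C^n$, and let $\mathbb B_n$ and $\mathbb S_n$ be the open unit ball and the unit sphere. Let $v$ be volume measure on $\mathbb B_n$ and, for real $\alpha$, $dv_\alpha(z)=(1-|z|^2)^\alpha\,dv(z)$, normalized to be a probability measure when $\alpha>-1$. For $f$ holomorphic in $\mathbb B_n$ let $Rf(z)=\sum_j z_j\,\frac{\partial f}{\partial z_j}(z)$ be the radial derivative, $R^k$ its $k$-th iterate and $R^0f=f$. For $p>0$ and real $\alpha$ let $N$ be the smallest nonnegative integer with $pN+\alpha>-1$. The space $A^p_\alpha$ consists of all holomorphic $f$ in $\mathbb B_n$ such that $(1-|z|^2)^N R^Nf(z)$ belongs to $L^p(\mathbb B_n,dv_\alpha)$, and $$\|f\|_{p,\alpha}=|f(0)|+\Bigl[\int_{\mathbb B_n}(1-|z|^2)^{pN}|R^Nf(z)|^p\,dv_\alpha(z)\Bigr]^{1/p}.$$ For $\zeta\in\mathbb S_n$ and $r>0$ let $Q_r(\zeta)=\{z\in\mathbb B_n:|1-\langle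 z,\zeta\rangle|<r\}$. For $a\in\mathbb B_n$ and $R>0$ let $D(a,R)=\{z\in\mathbb B_n:\beta(z,a)<R\}$, where $\beta(z,w)$ is the distance in the Bergman metric, that is, the infimum over all $C^1$ curves $\gamma:[0,1]\to\mathbb B_n$ from $z$ to $w$ of $$\int_0^1\Bigl(\frac{|\gamma'(t)|^2}{1-|\gamma(t)|^2}+\frac{|\langle\gamma'(t),\gamma(t)\rangle|^2}{(1-|\gamma(t)|^2)^2}\Bigr)^{1/2}dt .$$ **Theorem.** Suppose $0<p\le q<\infty$, $\alpha$ is real, and $k$ is a nonnegative integer with $\alpha+kp>-1$. Let $\mu$ be a positive Borel measure on $\mathbb B_n$ which, if $k\ge1$, is finite on some neighbourhood of $0$ (as is every Borel measure that is finite on compact subsets of $\mathbb B_n$). Put $$d=\frac{(n+1+\alpha+kp)\,q}{p}.$$ Then the following conditions are equivalent. (a) There is a constant $C>0$ such that $\int_{\mathbb B_n}|R^kf(w)|^q\,d\mu(w)\le C\|f\|_{p,\alpha}^q$ for all $f\in A^p_\alpha$. (b) For each $s>0$ there is a constant $C>0$ such that $$\int_{\mathbb B_n}\frac{(1-|z|^2)^s}{|1-\langle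 z,w\rangle|^{s+d}}\,d\mu(w)\le C\qquad\text{for all } z\in\mathbb B_n.$$ (b') For some $s>0$ there is a constant $C>0$ such that the inequality in (b) holds for all $z\in\mathbb B_n$. (c) There is a constant $C>0$ such that $\mu(Q_r(\zeta))\le Cr^d$ for all $r>0$ and all $\zeta\in\mathbb S_n$. (d) For each $R>0$ there is a constant $C>0$ such that $\mu(D(a,R))\le C(1-|a|^2)^d$ for all $a\in\mathbb B_n$. (d') For some $R>0$ there is a constant $C>0$ such that the inequality in (d) holds for all $a\in\mathbb B_n$. -/

import Mathlib

open MeasureTheory Set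

namespace BergmanCarleson

noncomputable section

/-- The complex Euclidean space `ℂⁿ`. -/
abbrev Cn (n : ℕ) : Type := EuclideanSpace ℂ (Fin n)

/-- The open unit ball of `ℂⁿ`. -/
def unitBall (n : ℕ) : Set (Cn n) := Metric.ball 0 1

/-- The unit sphere of `ℂⁿ`. -/
def unitSphere (n : ℕ) : Set (Cn n) := Metric.sphere 0 1

/-- The Hermitian product `⟨z, w⟩ = ∑ zⱼ * conj wⱼ`, linear in the first variable. -/
def herm {n : ℕ} (z w : Cn n) : ℂ := ∑ j, z j * (starRingEnd ℂ) (w j)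

/-- Holomorphic functions in the unit ball; the values outside the ball are irrelevant. -/
def IsHolomorphic {n : ℕ} (f : Cn n → ℂ) : Prop := DifferentiableOn ℂ f (unitBall n)

/-- The radial derivative `R f (z) = ∑ zⱼ ∂f/∂zⱼ (z)`. -/
def radialDeriv {n : ℕ} (f : Cn n → ℂ) (z : Cn n) : ℂ :=
  ∑ j, z j * fderiv ℂ f z (EuclideanSpace.single j 1)

/-- The iterated radial derivative `R^k f`, with `R^0 f = f`. -/
def radialDerivIter {n : ℕ} (k : ℕ) (f : Cn n → ℂ) : Cn n → ℂ := radialDeriv^[k] f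

/-- The measure `(1 - |z|²)^α dv(z)` on the unit ball, without normalization. -/
def weightedVolume (n : ℕ) (α : ℝ) : Measure (Cn n) :=
  (volume.restrict (unitBall n)).withDensity fun z => ENNReal.ofReal ((1 - ‖z‖ ^ 2) ^ α)

open Classical in
/-- The measure `dv_α`: it is `(1 - |z|²)^α dv(z)` on the unit ball, normalized to have total
mass one in the case `α > -1` in which its total mass is finite. -/
def volumeAlpha (n : ℕ) (α : ℝ) : Measure (Cn n) :=
  if -1 < α then (weightedVolume n α univ)⁻¹ • weightedVolume n α else weightedVolume n α

/-- The smallest nonnegative integer `N` such that `p N + α > -1`. -/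
def minOrder (p α : ℝ) : ℕ := sInf {N : ℕ | -1 < p * N + α}

/-- The function `(1 - |z|²)^N R^N f(z)` with `N` the smallest nonnegative integer such that
`p N + α > -1`. -/
def weightedDeriv {n : ℕ} (p α : ℝ) (f : Cn n → ℂ) (z : Cn n) : ℂ :=
  (((1 - ‖z‖ ^ 2) ^ minOrder p α : ℝ) : ℂ) * radialDerivIter (minOrder p α) f z

/-- The generalized weighted Bergman space `A^p_α`: all holomorphic `f` in the unit ball such that
`(1 - |z|²)^N R^N f(z)` belongs to `L^p(dv_α)`. -/
def bergmanSpace (n : ℕ) (p α : ℝ) : Set (Cn n → ℂ) :=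
  {f | IsHolomorphic f ∧ MemLp (weightedDeriv p α f) (ENNReal.ofReal p) (volumeAlpha n α)}

/-- `‖f‖_{p,α} = |f(0)| + (∫ (1 - |z|²)^{pN} |R^N f(z)|^p dv_α(z))^{1/p}`. -/
def bergmanNorm {n : ℕ} (p α : ℝ) (f : Cn n → ℂ) : ℝ :=
  ‖f 0‖ + (eLpNorm (weightedDeriv p α f) (ENNReal.ofReal p) (volumeAlpha n α)).toReal

/-- The Carleson region `Q_r(ζ) = {z in the ball : |1 - ⟨z, ζ⟩| < r}`. -/
def carlesonRegion {n : ℕ} (r : ℝ) (ζ : Cn n) : Set (Cn n) :=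
  {z | z ∈ unitBall n ∧ ‖1 - herm z ζ‖ < r}

/-- The Bergman metric of the unit ball, as a quadratic form in the tangent vector `u` at `z`:
`∑ gᵢⱼ uᵢ conj uⱼ` where `gᵢⱼ = (n+1)⁻¹ ∂²/∂zᵢ∂(conj zⱼ) log K(z, z)` and
`K(z, z) = (1 - |z|²)^{-(n+1)}` is the Bergman kernel on the diagonal, that is,
`gᵢⱼ = δᵢⱼ / (1 - |z|²) + conj zᵢ * zⱼ / (1 - |z|²)²`. -/
def bergmanForm {n : ℕ} (z u : Cn n) : ℝ :=
  ‖u‖ ^ 2 / (1 - ‖z‖ ^ 2) + ‖herm u z‖ ^ 2 / (1 - ‖z‖ ^ 2) ^ 2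

/-- The `C¹` curves in the unit ball, parametrized by `[0, 1]`, from `z` to `w`. -/
def curvesBetween {n : ℕ} (z w : Cn n) : Set (ℝ → Cn n) :=
  {γ | ContDiffOn ℝ 1 γ (Icc 0 1) ∧ MapsTo γ (Icc 0 1) (unitBall n) ∧ γ 0 = z ∧ γ 1 = w}

/-- The length of a curve in the Bergman metric. -/
def bergmanLength {n : ℕ} (γ : ℝ → Cn n) : ℝ :=
  ∫ t in (0 : ℝ)..1, Real.sqrt (bergmanForm (γ t) (derivWithin γ (Icc 0 1) t))

/-- The distance `β(z, w)` in the Bergman metric: the infimum of the lengths of the `C¹` curves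
in the unit ball from `z` to `w`. -/
def bergmanDist {n : ℕ} (z w : Cn n) : ℝ := sInf (bergmanLength '' curvesBetween z w)

/-- The Bergman metric ball `D(a, R)`. -/
def bergmanBall {n : ℕ} (a : Cn n) (R : ℝ) : Set (Cn n) :=
  {z | z ∈ unitBall n ∧ bergmanDist z a < R}

/-- For the given `s`, the integrals `∫ (1 - |z|²)^s / |1 - ⟨z, w⟩|^{s + d} dμ(w)` over the
unit ball are bounded uniformly for `z` in the unit ball. -/
def BerezinBounded {n : ℕ} (μ : Measure (Cn n)) (d s : ℝ) : Prop :=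
  ∃ C : ℝ, 0 < C ∧ ∀ z ∈ unitBall n,
    ∫⁻ w in unitBall n, ENNReal.ofReal ((1 - ‖z‖ ^ 2) ^ s / ‖1 - herm z w‖ ^ (s + d)) ∂μ
      ≤ ENNReal.ofReal C

/-- For the given `R`, `μ(D(a, R)) ≤ C (1 - |a|²)^d` for all `a` in the unit ball. -/
def BergmanBallBounded {n : ℕ} (μ : Measure (Cn n)) (d R : ℝ) : Prop :=
  ∃ C : ℝ, 0 < C ∧ ∀ a ∈ unitBall n, μ (bergmanBall a R) ≤ ENNReal.ofReal (C * (1 - ‖a‖ ^ 2) ^ d)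

end

end BergmanCarleson

namespace BergmanCarleson

noncomputable section

open Real Metric Filter Topology

/-! Write ρ = 1 - |w|². Near w, Bergman geometry has scale ρ in the complex direction of w and √ρ in
the orthogonal ones, so a Bergman ball has volume of order ρ^(n+1). On a set of this shape |R^k f|^p
is controlled by ρ^(-(n+1+α+kp)) times the local part of the integral defining the norm. The
exponent d is this one multiplied by q/p.

Sufficiency, (d') ⇒ (a): explicit boxes replace Bergman balls, so no automorphisms of the ball are
needed. The sub-mean value property of |R^N f|^p on a box, together with Cauchy's estimate along l ↦
e^l w for the remaining k - N radial derivatives, gives the local bound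
`exists_norm_radialDerivIter_rpow_le_energyMeasure`. Raised to the power q/p ≥ 1, the local energy
is at most a power of the total energy times itself. Tonelli (`lintegral_mul_measure_boxRegion_le`)
then exchanges box and centre: the centres w whose box contains z lie in D(z, R), where (d')
applies. No lattice or covering lemma is used.

Necessity, (a) ⇒ (c): test on (1 - ⟨w, a⟩)⁻ᵇ with a = (1 - r)ζ and b large. Its k-th radial
derivative has size at least c r^(-(b+k)) on Q_r(ζ), while its norm is O(r^((n+1+α)/p - b)). Large r
needs μ(𝔹) < ∞, which comes from testing on 1 or on the coordinates.

Geometry: (c) ⇒ (b) is a dyadic decomposition (`berezinBounded_of_carlesonBounded`), and applied to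
v_t it also yields the Forelli–Rudin estimate for the norms of the test functions. (b') ⇒ (c)
evaluates at z = (1 - r)ζ. (c) ⇒ (d) holds because D(a, R) lies in a Carleson region of radius
comparable to 1 - |a|². The return from (d') to (c) passes through (a). -/

/-! ### Subharmonicity in one variable -/

/-- The logarithm of the modulus of a holomorphic function is subharmonic. -/
lemma log_norm_le_circleAverage {f : ℂ → ℂ} (hf : AnalyticOnNhd ℂ f (closedBall 0 1))
    (h0 : f 0 ≠ 0) : log ‖f 0‖ ≤ circleAverage (fun z => log ‖f z‖) 0 1 := by
  have hf' : AnalyticOnNhd ℂ f (closedBall 0 |1|) := by simpa using hf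
  -- Jensen's formula: the mean exceeds log ‖f 0‖ by the sum of log (1/|u|) over the zeros u in the
  -- disc, with multiplicity.
  rw [hf'.circleAverage_log_norm one_ne_zero h0]
  refine le_add_of_nonneg_left (finsum_nonneg fun u => ?_)
  by_cases hu : u ∈ closedBall (0 : ℂ) |1|
  · refine mul_nonneg (mod_cast MeromorphicOn.AnalyticOnNhd.divisor_nonneg hf' u) ?_
    have hu' : ‖u‖ ≤ 1 := by simpa using hu
    rcases eq_or_ne u 0 with rfl | hne
    -- At u = 0 the factor is log 0, which is 0 by convention.
    · simp
    · refine log_nonneg ?_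
      simpa using (one_le_inv₀ (norm_pos_iff.2 hne)).2 hu'
  · simp [Function.locallyFinsuppWithin.apply_eq_zero_of_notMem _ hu]

/-- As f does not vanish identically on the connected disc, its zeros are isolated, and the
complement of a discrete set is conull. Taking logarithms of ‖f‖ on the circle is legitimate only
off these zeros. -/
lemma ae_circleMap_ne_zero {f : ℂ → ℂ} (hf : AnalyticOnNhd ℂ f (closedBall 0 1))
    (h0 : f 0 ≠ 0) : ∀ᵐ θ : ℝ, f (circleMap 0 1 θ) ≠ 0 := by
  have h1 := hf.preimage_zero_mem_codiscreteWithin h0 (by simp)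
    ((convex_closedBall (0 : ℂ) 1).isConnected ⟨0, by simp⟩)
  have h2 : f ⁻¹' {0}ᶜ ∈ codiscreteWithin (sphere (0 : ℂ) |1|) :=
    codiscreteWithin_mono (by simpa using sphere_subset_closedBall) h1
  have h3 : ∀ᶠ θ in codiscrete ℝ, f (circleMap 0 1 θ) ≠ 0 :=
    circleMap_preimage_codiscrete one_ne_zero h2
  have h4 := ae_restrict_le_codiscreteWithin (μ := (volume : Measure ℝ)) MeasurableSet.univ h3
  rwa [Measure.restrict_univ] at h4

/-- The powers of the modulus of a holomorphic function are subharmonic. -/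
lemma norm_rpow_le_integral {f : ℂ → ℂ} (hf : AnalyticOnNhd ℂ f (closedBall 0 1)) {p : ℝ}
    (hp : 0 < p) :
    2 * π * ‖f 0‖ ^ p ≤ ∫ θ in (0 : ℝ)..2 * π, ‖f (circleMap 0 1 θ)‖ ^ p := by
  by_cases h0 : f 0 = 0
  · rw [h0, norm_zero, zero_rpow hp.ne', mul_zero]
    exact intervalIntegral.integral_nonneg (by positivity) fun θ _ => by positivity
  have hlog := log_norm_le_circleAverage hf h0
  have hli : CircleIntegrable (fun z => log ‖f z‖) 0 1 :=
    MeromorphicOn.circleIntegrable_log_norm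
      (hf.mono (by simpa using sphere_subset_closedBall)).meromorphicOn
  have hcont : Continuous fun θ : ℝ => ‖f (circleMap 0 1 θ)‖ ^ p := by
    refine Continuous.rpow_const (Continuous.norm ?_) fun _ => Or.inr hp.le
    exact hf.continuousOn.comp_continuous (continuous_circleMap 0 1)
      fun θ => sphere_subset_closedBall (circleMap_mem_sphere 0 zero_le_one θ)
  have hpos : 0 < ‖f 0‖ := norm_pos_iff.2 h0
  have hint : IntervalIntegrable (fun θ => log ‖f (circleMap 0 1 θ)‖) volume 0 (2 * π) := hli
  have hint2 := (hint.sub (intervalIntegrable_const (c := log ‖f 0‖))).const_mul p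
  have hint3 := (intervalIntegrable_const (c := (1 : ℝ))).add hint2
  -- This is exp x ≥ 1 + x at x = p (log ‖f(e^{iθ})‖ - log ‖f 0‖), multiplied by ‖f 0‖^p. After
  -- integration the logarithmic term is nonnegative by subharmonicity of log ‖f‖.
  have hmono : ∫ θ in (0 : ℝ)..2 * π,
      ‖f 0‖ ^ p * (1 + p * (log ‖f (circleMap 0 1 θ)‖ - log ‖f 0‖)) ≤
      ∫ θ in (0 : ℝ)..2 * π, ‖f (circleMap 0 1 θ)‖ ^ p := by
    refine intervalIntegral.integral_mono_ae (by positivity) (hint3.const_mul _)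
      (hcont.intervalIntegrable _ _) ?_
    filter_upwards [ae_circleMap_ne_zero hf h0] with θ hθ
    have hθ' : 0 < ‖f (circleMap 0 1 θ)‖ := norm_pos_iff.2 hθ
    have h := add_one_le_exp (p * (log ‖f (circleMap 0 1 θ)‖ - log ‖f 0‖))
    rw [← log_div hθ'.ne' hpos.ne', mul_comm, exp_mul, exp_log (by positivity),
      div_rpow hθ'.le hpos.le, le_div_iff₀ (by positivity)] at h
    rw [← log_div hθ'.ne' hpos.ne']
    linarith
  refine le_trans ?_ hmono
  have hJ : 2 * π * log ‖f 0‖ ≤ ∫ θ in (0 : ℝ)..2 * π, log ‖f (circleMap 0 1 θ)‖ := by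
    rw [circleAverage, smul_eq_mul, inv_mul_eq_div, le_div_iff₀ (by positivity)] at hlog
    linarith
  rw [intervalIntegral.integral_const_mul, intervalIntegral.integral_add intervalIntegrable_const
    hint2, intervalIntegral.integral_const_mul,
    intervalIntegral.integral_sub hint intervalIntegrable_const]
  simp only [intervalIntegral.integral_const, smul_eq_mul, sub_zero, mul_one]
  rw [mul_comm]
  refine mul_le_mul_of_nonneg_left ?_ (by positivity)
  nlinarith [mul_nonneg hp.le (sub_nonneg.2 hJ)]

/-! ### Holomorphy of derivatives in several variables -/

/-- The derivative of a bounded holomorphic function is bounded at interior points. -/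
lemma norm_fderiv_le_of_bounded {E : Type*} [NormedAddCommGroup E] [NormedSpace ℂ E] {f : E → ℂ}
    {y : E} {r M : ℝ} (hr : 0 < r) (hd : DifferentiableOn ℂ f (ball y r))
    (hM : ∀ z ∈ ball y r, ‖f z‖ ≤ M) : ‖fderiv ℂ f y‖ ≤ 2 * M / r := by
  have hM0 : 0 ≤ M := (norm_nonneg _).trans (hM y (mem_ball_self hr))
  refine ContinuousLinearMap.opNorm_le_bound _ (by positivity) fun u => ?_
  rcases eq_or_ne u 0 with rfl | hu
  · simp
  have hu' : 0 < ‖u‖ := norm_pos_iff.2 hu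
  set R : ℝ := r / (2 * ‖u‖) with hR
  have hR0 : 0 < R := by positivity
  have hmem : ∀ l : ℂ, l ∈ closedBall (0 : ℂ) R → y + l • u ∈ ball y r := by
    intro l hl
    rw [mem_closedBall_zero_iff] at hl
    rw [mem_ball_iff_norm, add_sub_cancel_left, norm_smul]
    calc ‖l‖ * ‖u‖ ≤ R * ‖u‖ := by gcongr
      _ = r / 2 := by rw [hR]; field_simp
      _ < r := by linarith
  have hline : ∀ l : ℂ, HasDerivAt (fun l : ℂ => y + l • u) u l := fun l => by
    simpa using ((hasDerivAt_id l).smul_const u).const_add y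
  have hdl : DifferentiableOn ℂ (fun l : ℂ => f (y + l • u)) (closedBall 0 R) := fun l hl =>
    ((hd.differentiableAt (isOpen_ball.mem_nhds (hmem l hl))).comp l
      (hline l).differentiableAt).differentiableWithinAt
  have hder : deriv (fun l : ℂ => f (y + l • u)) 0 = fderiv ℂ f y u := by
    have h1 : HasFDerivAt f (fderiv ℂ f y) (y + (0 : ℂ) • u) := by
      simpa using (hd.differentiableAt (isOpen_ball.mem_nhds (mem_ball_self hr))).hasFDerivAt
    exact (h1.comp_hasDerivAt (0 : ℂ) (hline 0)).deriv
  have hb := Complex.norm_deriv_le_of_forall_mem_sphere_norm_le hR0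
    (DifferentiableOn.diffContOnCl (by rw [closure_ball _ hR0.ne']; exact hdl)) (C := M)
    fun l hl => hM _ (hmem l (sphere_subset_closedBall hl))
  rw [hder] at hb
  refine hb.trans (le_of_eq ?_)
  rw [hR]; field_simp

/-- Directional derivatives of holomorphic functions are holomorphic. -/
lemma differentiableOn_fderiv_apply {E : Type*} [NormedAddCommGroup E] [NormedSpace ℂ E]
    [MeasurableSpace E] [BorelSpace E] [SecondCountableTopology E] [FiniteDimensional ℂ E]
    {f : E → ℂ} {U : Set E} (hU : IsOpen U) (hf : DifferentiableOn ℂ f U) (v : E) :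
    DifferentiableOn ℂ (fun z => fderiv ℂ f z v) U := by
  intro z₀ hz₀
  refine DifferentiableAt.differentiableWithinAt ?_
  -- Three radii: z ranges over radius r, the Cauchy circle about z adds less than r, and the
  -- derivative bound at its points needs a further ball of radius r.
  obtain ⟨r, hr, hrU, hM⟩ : ∃ r > 0, ball z₀ (3 * r) ⊆ U ∧
      ∀ z ∈ ball z₀ (3 * r), ‖f z‖ ≤ ‖f z₀‖ + 1 := by
    have h1 := hU.mem_nhds hz₀
    have h2 : ∀ᶠ z in 𝓝 z₀, ‖f z‖ < ‖f z₀‖ + 1 :=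
      (hf.differentiableAt h1).continuousAt.norm.eventually_lt continuousAt_const (by simp)
    obtain ⟨r, hr, h⟩ := Metric.mem_nhds_iff.1 (Filter.inter_mem h1 h2)
    refine ⟨r / 3, by positivity, ?_, ?_⟩ <;> rw [mul_div_cancel₀ _ (by norm_num : (3 : ℝ) ≠ 0)]
    · exact fun z hz => (h hz).1
    · exact fun z hz => (h hz).2.le
  set M := ‖f z₀‖ + 1
  obtain ⟨δ, hδ, hδv⟩ : ∃ δ > 0, δ * ‖v‖ < r := by
    refine ⟨r / (‖v‖ + 1), by positivity, ?_⟩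
    rw [div_mul_eq_mul_div, div_lt_iff₀ (by positivity)]
    nlinarith [norm_nonneg v]
  have hfd : ∀ y ∈ ball z₀ (3 * r), DifferentiableAt ℂ f y := fun y hy =>
    hf.differentiableAt (hU.mem_nhds (hrU hy))
  have hmem : ∀ z ∈ ball z₀ r, ∀ l ∈ closedBall (0 : ℂ) δ, z + l • v ∈ ball z₀ (2 * r) := by
    intro z hz l hl
    rw [mem_closedBall_zero_iff] at hl
    rw [mem_ball_iff_norm] at hz ⊢
    calc ‖z + l • v - z₀‖ = ‖(z - z₀) + l • v‖ := by congr 1; abel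
      _ ≤ ‖z - z₀‖ + ‖l‖ * ‖v‖ := by rw [← norm_smul]; exact norm_add_le _ _
      _ < r + r := by
        have : ‖l‖ * ‖v‖ ≤ δ * ‖v‖ := by gcongr
        linarith
      _ = 2 * r := by ring
  have h23 : ball z₀ (2 * r) ⊆ ball z₀ (3 * r) := ball_subset_ball (by linarith)
  have hbound : ∀ y ∈ ball z₀ (2 * r), ‖fderiv ℂ f y‖ ≤ 2 * M / r := by
    intro y hy
    have hsub : ball y r ⊆ ball z₀ (3 * r) := by
      refine ball_subset_ball' ?_
      rw [mem_ball] at hy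
      linarith
    exact norm_fderiv_le_of_bounded hr (fun z hz => (hfd z (hsub hz)).differentiableWithinAt)
      fun z hz => hM z (hsub hz)
  let c : ℝ → ℂ := circleMap 0 δ
  let κ : ℝ → ℂ := fun θ => deriv c θ * (1 / (c θ - 0) ^ 2)
  have hcne : ∀ θ, c θ ≠ 0 := fun θ => circleMap_ne_center hδ.ne'
  have hccont : Continuous c := continuous_circleMap 0 δ
  have hcmem : ∀ θ, c θ ∈ closedBall (0 : ℂ) δ := fun θ =>
    sphere_subset_closedBall (circleMap_mem_sphere 0 hδ.le θ)
  have hκ : Continuous κ := by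
    have h1 : deriv c = fun θ => c θ * Complex.I := by
      funext θ
      simp [c, deriv_circleMap]
    simp only [κ, h1]
    refine (hccont.mul continuous_const).mul (continuous_const.div ?_ ?_)
    · fun_prop
    · intro θ
      simpa using hcne θ
  -- Cauchy's formula on the complex line through z in direction v. On the right z occurs only
  -- inside f, so a single differentiation of f suffices.
  have hformula : ∀ z ∈ ball z₀ r, (2 * π * Complex.I) * fderiv ℂ f z v =
      ∫ θ in (0 : ℝ)..2 * π, κ θ * f (z + c θ • v) := by
    intro z hz
    have hline : ∀ l : ℂ, HasDerivAt (fun l : ℂ => z + l • v) v l := fun l => by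
      simpa using ((hasDerivAt_id l).smul_const v).const_add z
    have hdl : DifferentiableOn ℂ (fun l : ℂ => f (z + l • v)) (closedBall 0 δ) := fun l hl =>
      ((hfd _ (h23 (hmem z hz l hl))).comp l (hline l).differentiableAt).differentiableWithinAt
    have h := hdl.deriv_eq_smul_circleIntegral hδ
    have hder : deriv (fun l : ℂ => f (z + l • v)) 0 = fderiv ℂ f z v := by
      have h1 : HasFDerivAt f (fderiv ℂ f z) (z + (0 : ℂ) • v) := by
        simpa using (hfd z (ball_subset_ball (by linarith) hz)).hasFDerivAt
      exact (h1.comp_hasDerivAt (0 : ℂ) (hline 0)).deriv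
    rw [hder, smul_eq_mul] at h
    rw [← h, circleIntegral]
    simp only [smul_eq_mul, κ, mul_assoc]
    rfl
  have hcontline : ∀ z ∈ ball z₀ r, Continuous fun θ => f (z + c θ • v) := by
    intro z hz
    refine continuous_iff_continuousAt.2 fun θ => ?_
    exact ContinuousAt.comp (f := fun θ => z + c θ • v) (x := θ)
      (hfd _ (h23 (hmem z hz _ (hcmem θ)))).continuousAt (by fun_prop)
  obtain ⟨K, hK⟩ : ∃ K, ∀ θ ∈ uIcc 0 (2 * π), ‖κ θ‖ ≤ K := by
    exact isCompact_uIcc.exists_bound_of_continuousOn hκ.continuousOn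
  -- Differentiation under the integral asks only for measurability and boundedness of `fderiv ℂ f`,
  -- not for its continuity, which is not yet known.
  have hD := intervalIntegral.hasFDerivAt_integral_of_dominated_of_fderiv_le (𝕜 := ℂ)
    (μ := volume) (a := 0) (b := 2 * π) (s := ball z₀ r) (x₀ := z₀)
    (F := fun z θ => κ θ * f (z + c θ • v))
    (F' := fun z θ => κ θ • fderiv ℂ f (z + c θ • v)) (bound := fun _ => K * (2 * M / r))
    (ball_mem_nhds z₀ hr)
    (by
      filter_upwards [ball_mem_nhds z₀ hr] with z hz
      exact (hκ.mul (hcontline z hz)).aestronglyMeasurable)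
    ((hκ.mul (hcontline z₀ (mem_ball_self hr))).intervalIntegrable _ _)
    (by
      refine AEStronglyMeasurable.smul hκ.aestronglyMeasurable ?_
      have : Measurable fun θ => fderiv ℂ f (z₀ + c θ • v) :=
        (measurable_fderiv ℂ f).comp (by fun_prop : Continuous fun θ => z₀ + c θ • v).measurable
      exact this.aestronglyMeasurable)
    (by
      refine ae_of_all _ fun θ hθ z hz => ?_
      rw [norm_smul]
      exact mul_le_mul (hK θ (uIoc_subset_uIcc hθ)) (hbound _ (hmem z hz _ (hcmem θ)))
        (norm_nonneg _) ((norm_nonneg _).trans (hK θ (uIoc_subset_uIcc hθ))))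
    intervalIntegrable_const
    (by
      refine ae_of_all _ fun θ _ z hz => ?_
      have h1 := (hfd _ (h23 (hmem z hz _ (hcmem θ)))).hasFDerivAt
      have h2 : HasFDerivAt (fun z : E => z + c θ • v) (ContinuousLinearMap.id ℂ E) z :=
        (hasFDerivAt_id z).add_const _
      simpa using (h1.comp z h2).const_mul (κ θ))
  have h2 : (fun z => fderiv ℂ f z v) =ᶠ[𝓝 z₀]
      fun z => (2 * π * Complex.I)⁻¹ * ∫ θ in (0 : ℝ)..2 * π, κ θ * f (z + c θ • v) := by
    filter_upwards [ball_mem_nhds z₀ hr] with z hz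
    rw [← hformula z hz, inv_mul_cancel_left₀ Complex.two_pi_I_ne_zero]
  exact (hD.differentiableAt.const_mul _).congr_of_eventuallyEq h2

/-! ### The Hermitian product and radial derivatives -/

variable {n : ℕ}

lemma herm_eq_inner (z w : Cn n) : herm z w = inner ℂ w z := by
  simp [herm, PiLp.inner_apply]

lemma re_herm_eq_inner (z w : Cn n) : (herm z w).re = inner ℝ w z := by
  simp [herm, PiLp.inner_apply]

lemma norm_herm_le (z w : Cn n) : ‖herm z w‖ ≤ ‖z‖ * ‖w‖ := by
  rw [herm_eq_inner, mul_comm]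
  exact norm_inner_le_norm w z

lemma herm_self (z : Cn n) : herm z z = ((‖z‖ ^ 2 : ℝ) : ℂ) := by
  rw [herm_eq_inner, inner_self_eq_norm_sq_to_K]
  norm_cast

lemma herm_add_left (z z' w : Cn n) : herm (z + z') w = herm z w + herm z' w := by
  simp only [herm_eq_inner, inner_add_right]

lemma herm_add_right (z w w' : Cn n) : herm z (w + w') = herm z w + herm z w' := by
  simp only [herm_eq_inner, inner_add_left]

lemma herm_sub_right (z w w' : Cn n) : herm z (w - w') = herm z w - herm z w' := by
  simp only [herm_eq_inner, inner_sub_left]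

lemma herm_smul_left (c : ℂ) (z w : Cn n) : herm (c • z) w = c * herm z w := by
  simp only [herm_eq_inner, inner_smul_right]

lemma herm_smul_right (c : ℂ) (z w : Cn n) : herm z (c • w) = (starRingEnd ℂ) c * herm z w := by
  simp only [herm_eq_inner, inner_smul_left]

lemma herm_real_smul_right (c : ℝ) (z w : Cn n) : herm z (c • w) = c * herm z w := by
  rw [show c • w = (c : ℂ) • w from (Complex.coe_smul c w).symm, herm_smul_right,
    Complex.conj_ofReal]

lemma norm_one_sub_herm_comm (z w : Cn n) : ‖1 - herm z w‖ = ‖1 - herm w z‖ := by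
  rw [herm_eq_inner, herm_eq_inner, ← inner_conj_symm, ← RCLike.norm_conj]
  simp

@[fun_prop]
lemma continuous_herm {X : Type*} [TopologicalSpace X] {f g : X → Cn n} (hf : Continuous f)
    (hg : Continuous g) : Continuous fun x => herm (f x) (g x) := by
  simp only [herm_eq_inner]
  exact hg.inner hf

lemma mem_unitBall {z : Cn n} : z ∈ unitBall n ↔ ‖z‖ < 1 := mem_ball_zero_iff

lemma isOpen_unitBall : IsOpen (unitBall n) := isOpen_ball

lemma measurableSet_unitBall : MeasurableSet (unitBall n) := measurableSet_ball

lemma one_sub_norm_sq_pos {z : Cn n} (hz : z ∈ unitBall n) : 0 < 1 - ‖z‖ ^ 2 := by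
  have h := mem_unitBall.1 hz
  nlinarith [norm_nonneg z]

/-- The unit vector in the direction of `z`, arbitrary for `z = 0`. -/
lemma exists_unit_direction (hn : 1 ≤ n) (z : Cn n) :
    ∃ ζ : Cn n, ‖ζ‖ = 1 ∧ z = ‖z‖ • ζ := by
  rcases eq_or_ne z 0 with rfl | hz
  · exact ⟨EuclideanSpace.single ⟨0, hn⟩ 1, by simp, by simp⟩
  · have := norm_ne_zero_iff.2 hz
    refine ⟨‖z‖⁻¹ • z, ?_, ?_⟩
    · rw [norm_smul, norm_inv, norm_norm, inv_mul_cancel₀ this]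
    · rw [smul_smul, mul_inv_cancel₀ this, one_smul]

lemma radialDeriv_eq_fderiv (f : Cn n → ℂ) (z : Cn n) : radialDeriv f z = fderiv ℂ f z z := by
  have h : z = ∑ j, z j • (EuclideanSpace.single j (1 : ℂ) : Cn n) := by
    ext i
    simp [Pi.single_apply]
  conv_rhs => rw [h, map_sum]
  simp only [radialDeriv, map_smul, smul_eq_mul]
  rw [← h]

lemma IsHolomorphic.differentiableAt {f : Cn n → ℂ} (hf : IsHolomorphic f) {z : Cn n}
    (hz : z ∈ unitBall n) : DifferentiableAt ℂ f z :=
  DifferentiableOn.differentiableAt hf (isOpen_unitBall.mem_nhds hz)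

lemma IsHolomorphic.radialDeriv {f : Cn n → ℂ} (hf : IsHolomorphic f) :
    IsHolomorphic (radialDeriv f) := by
  refine DifferentiableOn.fun_sum fun j _ => DifferentiableOn.mul ?_ ?_
  · exact (EuclideanSpace.proj (𝕜 := ℂ) j).differentiable.differentiableOn
  · exact differentiableOn_fderiv_apply isOpen_unitBall hf _

lemma radialDerivIter_succ (k : ℕ) (f : Cn n → ℂ) :
    radialDerivIter (k + 1) f = radialDeriv (radialDerivIter k f) :=
  Function.iterate_succ_apply' _ _ _

lemma radialDerivIter_add (j k : ℕ) (f : Cn n → ℂ) :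
    radialDerivIter (j + k) f = radialDerivIter j (radialDerivIter k f) :=
  Function.iterate_add_apply _ _ _ _

lemma IsHolomorphic.radialDerivIter {f : Cn n → ℂ} (hf : IsHolomorphic f) (k : ℕ) :
    IsHolomorphic (radialDerivIter k f) := by
  induction k with
  | zero => exact hf
  | succ k ih => rw [radialDerivIter_succ]; exact ih.radialDeriv

lemma radialDeriv_congr {f g : Cn n → ℂ} (h : EqOn f g (unitBall n)) :
    EqOn (radialDeriv f) (radialDeriv g) (unitBall n) := by
  intro z hz
  rw [radialDeriv_eq_fderiv, radialDeriv_eq_fderiv,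
    Filter.EventuallyEq.fderiv_eq (h.eventuallyEq_of_mem (isOpen_unitBall.mem_nhds hz))]

/-- The operator R generates the flow l ↦ e^l w, so iterates of R are ordinary iterated derivatives
in l, accessible to one-variable Cauchy estimates. -/
lemma hasDerivAt_comp_exp_smul {f : Cn n → ℂ} {w : Cn n} {l : ℂ}
    (hf : DifferentiableAt ℂ f (Complex.exp l • w)) :
    HasDerivAt (fun l : ℂ => f (Complex.exp l • w)) (radialDeriv f (Complex.exp l • w)) l := by
  rw [radialDeriv_eq_fderiv]
  exact hf.hasFDerivAt.comp_hasDerivAt l ((Complex.hasDerivAt_exp l).smul_const w)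

lemma iteratedDeriv_comp_exp_smul {f : Cn n → ℂ} (hf : IsHolomorphic f) (w : Cn n) (k : ℕ) :
    ∀ l : ℂ, Complex.exp l • w ∈ unitBall n →
      iteratedDeriv k (fun l : ℂ => f (Complex.exp l • w)) l =
        radialDerivIter k f (Complex.exp l • w) := by
  induction k with
  | zero => intro l _; simp [radialDerivIter]
  | succ k ih =>
    intro l hl
    have ho : IsOpen {l : ℂ | Complex.exp l • w ∈ unitBall n} :=
      isOpen_unitBall.preimage (by fun_prop)
    have he : iteratedDeriv k (fun l : ℂ => f (Complex.exp l • w)) =ᶠ[𝓝 l]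
        fun l => radialDerivIter k f (Complex.exp l • w) := by
      filter_upwards [ho.mem_nhds hl] with l' hl'
      exact ih l' hl'
    rw [iteratedDeriv_succ, he.deriv_eq, radialDerivIter_succ]
    exact (hasDerivAt_comp_exp_smul ((hf.radialDerivIter k).differentiableAt hl)).deriv

/-- Cauchy's estimate for iterated radial derivatives. -/
lemma norm_radialDerivIter_le {f : Cn n → ℂ} (hf : IsHolomorphic f) (k : ℕ) {w : Cn n} {δ M : ℝ}
    (hδ : 0 < δ) (hmem : ∀ l : ℂ, ‖l‖ ≤ δ → Complex.exp l • w ∈ unitBall n)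
    (hM : ∀ l : ℂ, ‖l‖ ≤ δ → ‖f (Complex.exp l • w)‖ ≤ M) :
    ‖radialDerivIter k f w‖ ≤ k.factorial * M / δ ^ k := by
  have h0 := iteratedDeriv_comp_exp_smul hf w k 0 (hmem 0 (by simpa using hδ.le))
  rw [Complex.exp_zero, one_smul] at h0
  rw [← h0]
  refine Complex.norm_iteratedDeriv_le_of_forall_mem_sphere_norm_le k hδ
    (DifferentiableOn.diffContOnCl fun l hl => ?_) fun l hl => hM l ?_
  · rw [closure_ball _ hδ.ne', mem_closedBall_zero_iff] at hl
    exact (hasDerivAt_comp_exp_smul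
      (hf.differentiableAt (hmem l hl))).differentiableAt.differentiableWithinAt
  · exact (mem_sphere_zero_iff_norm.1 hl).le

/-! ### The sub-mean value property on circled sets -/

lemma measurePreserving_smul_of_norm_eq_one {c : ℂ} (hc : ‖c‖ = 1) :
    MeasurePreserving (fun z : Cn n => c • z) := by
  have hc0 : c ≠ 0 := norm_ne_zero_iff.1 (by rw [hc]; exact one_ne_zero)
  let e : Cn n ≃ₗᵢ[ℝ] Cn n :=
    { (LinearEquiv.smulOfNeZero ℂ (Cn n) c hc0).restrictScalars ℝ with
      norm_map' := fun z => by
        show ‖c • z‖ = ‖z‖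
        rw [norm_smul, hc, one_mul] }
  exact e.measurePreserving

/-- Powers of the modulus of a holomorphic function have the sub-mean value property on the
translates of circled sets. -/
lemma norm_rpow_mul_volume_le {f : Cn n → ℂ} (hf : IsHolomorphic f) {p : ℝ} (hp : 0 < p)
    {E : Set (Cn n)} (hE : MeasurableSet E) {w : Cn n}
    (hcirc : ∀ ζ ∈ E, ∀ l : ℂ, ‖l‖ ≤ 1 → l • ζ ∈ E) (hwE : ∀ ζ ∈ E, w + ζ ∈ unitBall n) :
    ENNReal.ofReal (‖f w‖ ^ p) * volume E ≤
      ∫⁻ ζ in E, ENNReal.ofReal (‖f (w + ζ)‖ ^ p) := by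
  -- Extension by zero makes the integrand measurable on the whole space; on w + E nothing changes.
  set g : Cn n → ENNReal := (unitBall n).indicator fun z => ENNReal.ofReal (‖f z‖ ^ p) with hg
  have hgm : Measurable g := by
    classical
    have hc : ContinuousOn (fun z => ENNReal.ofReal (‖f z‖ ^ p)) (unitBall n) :=
      ENNReal.continuous_ofReal.comp_continuousOn
        ((DifferentiableOn.continuousOn hf).norm.rpow_const fun _ _ => Or.inr hp.le)
    rw [hg, ← piecewise_eq_indicator]
    exact hc.measurable_piecewise continuousOn_const measurableSet_unitBall
  have hgE : ∀ ζ ∈ E, g (w + ζ) = ENNReal.ofReal (‖f (w + ζ)‖ ^ p) := fun ζ hζ => by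
    rw [hg, indicator_of_mem (hwE ζ hζ)]
  have hcm : ∀ θ : ℝ, ‖circleMap 0 1 θ‖ = 1 := fun θ => by simp
  -- The one-variable inequality on the disc l ↦ w + l ζ, which stays in w + E because E is circled.
  -- Integrating over ζ in E and using the rotation invariance of E removes the angle θ.
  have hslice : ∀ ζ ∈ E, ENNReal.ofReal (2 * π) * ENNReal.ofReal (‖f w‖ ^ p) ≤
      ∫⁻ θ in Ioc 0 (2 * π), g (w + circleMap 0 1 θ • ζ) := by
    intro ζ hζ
    have hmem : ∀ l : ℂ, l ∈ closedBall (0 : ℂ) 1 → w + l • ζ ∈ unitBall n := fun l hl =>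
      hwE _ (hcirc ζ hζ l (by simpa using hl))
    have ho : IsOpen {l : ℂ | w + l • ζ ∈ unitBall n} := isOpen_unitBall.preimage (by fun_prop)
    have hd : DifferentiableOn ℂ (fun l : ℂ => f (w + l • ζ)) {l : ℂ | w + l • ζ ∈ unitBall n} := by
      intro l hl
      exact ((hf.differentiableAt hl).comp l (by fun_prop :
        DifferentiableAt ℂ (fun l : ℂ => w + l • ζ) l)).differentiableWithinAt
    have ha : AnalyticOnNhd ℂ (fun l : ℂ => f (w + l • ζ)) (closedBall 0 1) :=
      (hd.analyticOnNhd ho).mono hmem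
    have h := norm_rpow_le_integral ha hp
    simp only [zero_smul, add_zero] at h
    have hci : Continuous fun θ : ℝ => ‖f (w + circleMap 0 1 θ • ζ)‖ ^ p := by
      refine Continuous.rpow_const (Continuous.norm ?_) fun _ => Or.inr hp.le
      exact ha.continuousOn.comp_continuous (continuous_circleMap 0 1)
        fun θ => sphere_subset_closedBall (circleMap_mem_sphere 0 zero_le_one θ)
    rw [← ENNReal.ofReal_mul (by positivity)]
    refine (ENNReal.ofReal_le_ofReal h).trans (le_of_eq ?_)
    rw [intervalIntegral.integral_of_le (by positivity),
      ofReal_integral_eq_lintegral_ofReal (hci.integrableOn_Ioc)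
        (ae_of_all _ fun θ => by positivity)]
    refine lintegral_congr fun θ => ?_
    rw [hgE _ (hcirc ζ hζ _ (hcm θ).le)]
  have hrot : ∀ θ : ℝ, ∫⁻ ζ in E, g (w + circleMap 0 1 θ • ζ) = ∫⁻ ζ in E, g (w + ζ) := by
    intro θ
    have hpre : (fun ζ : Cn n => circleMap 0 1 θ • ζ) ⁻¹' E = E := by
      ext ζ
      refine ⟨fun h => ?_, fun h => hcirc ζ h _ (hcm θ).le⟩
      have h2 := hcirc _ h (circleMap 0 1 θ)⁻¹ (by rw [norm_inv, hcm, inv_one])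
      rwa [inv_smul_smul₀ (circleMap_ne_center one_ne_zero)] at h2
    have h := (measurePreserving_smul_of_norm_eq_one (n := n) (hcm θ)).setLIntegral_comp_preimage
      hE (hgm.comp (measurable_const_add w))
    rwa [hpre] at h
  have hjm : Measurable fun x : Cn n × ℝ => g (w + circleMap 0 1 x.2 • x.1) := by
    refine hgm.comp (Continuous.measurable ?_)
    have := continuous_circleMap 0 1
    fun_prop
  have key : ENNReal.ofReal (2 * π) * (ENNReal.ofReal (‖f w‖ ^ p) * volume E) ≤
      ENNReal.ofReal (2 * π) * ∫⁻ ζ in E, g (w + ζ) := by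
    calc ENNReal.ofReal (2 * π) * (ENNReal.ofReal (‖f w‖ ^ p) * volume E)
        = ∫⁻ _ in E, ENNReal.ofReal (2 * π) * ENNReal.ofReal (‖f w‖ ^ p) := by
          rw [setLIntegral_const, mul_assoc]
      _ ≤ ∫⁻ ζ in E, ∫⁻ θ in Ioc 0 (2 * π), g (w + circleMap 0 1 θ • ζ) :=
          setLIntegral_mono' hE hslice
      _ = ∫⁻ θ in Ioc 0 (2 * π), ∫⁻ ζ in E, g (w + circleMap 0 1 θ • ζ) :=
          lintegral_lintegral_swap hjm.aemeasurable
      _ = ∫⁻ _ in Ioc 0 (2 * π), ∫⁻ ζ in E, g (w + ζ) := by simp only [hrot]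
      _ = ENNReal.ofReal (2 * π) * ∫⁻ ζ in E, g (w + ζ) := by
          rw [setLIntegral_const, Real.volume_Ioc, sub_zero, mul_comm]
  rw [ENNReal.mul_le_mul_iff_right (by simp [pi_pos]) ENNReal.ofReal_ne_top] at key
  rwa [setLIntegral_congr_fun hE hgE] at key

/-! ### Volumes of boxes and Carleson regions -/

/-- Real orthonormal coordinates of `ℂⁿ` in which the first two coordinates are the real and the
imaginary part of `⟨z, ζ⟩`. -/
lemma exists_orthonormal_coordinates {ζ : Cn n} (hn : 1 ≤ n) (hζ : ‖ζ‖ = 1) :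
    ∃ m : ℕ, m + 2 = 2 * n ∧ ∃ T : (Fin (m + 2) → ℝ) → Cn n, MeasurePreserving T ∧
      (∀ x, ‖T x‖ ^ 2 = ∑ i, x i ^ 2) ∧ ∀ x, herm (T x) ζ = x 0 + x 1 * Complex.I := by
  obtain ⟨m, hm⟩ : ∃ m : ℕ, m + 2 = 2 * n := ⟨2 * n - 2, by omega⟩
  refine ⟨m, hm, ?_⟩
  have hfr : Module.finrank ℝ (Cn n) = Fintype.card (Fin (m + 2)) := by
    rw [← Module.finrank_mul_finrank ℝ ℂ (Cn n)]
    simp [hm]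
  -- Only the values at 0 and 1 matter: the extension to an orthonormal basis keeps just these two.
  let v : Fin (m + 2) → Cn n := fun i => if i = 0 then ζ else Complex.I • ζ
  have hIζ : ‖Complex.I • ζ‖ = 1 := by rw [norm_smul, Complex.norm_I, one_mul, hζ]
  have h0 : inner ℝ (Complex.I • ζ) ζ = 0 := by
    rw [← re_herm_eq_inner, herm_smul_right, herm_self]
    simp only [Complex.conj_I, neg_mul, Complex.neg_re, Complex.I_mul_re, Complex.ofReal_im,
      neg_zero]
  have hv : Orthonormal ℝ (({0, 1} : Set (Fin (m + 2))).domRestrict v) := by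
    constructor
    · rintro ⟨i, hi⟩
      by_cases h : i = 0
      · simp [v, h, hζ]
      · simp [v, h, hIζ]
    · rintro ⟨i, hi⟩ ⟨j, hj⟩ hij
      rcases hi with rfl | rfl <;> rcases hj with rfl | rfl
      · exact absurd rfl hij
      · simp only [domRestrict_apply, v]
        rw [real_inner_comm]
        simpa using h0
      · simp only [domRestrict_apply, v]
        simpa using h0
      · exact absurd rfl hij
  obtain ⟨b, hb⟩ := hv.exists_orthonormalBasis_extension_of_card_eq hfr
  have hb0 : b 0 = ζ := by simpa [v] using hb 0 (by simp)
  have hb1 : b 1 = Complex.I • ζ := by simpa [v] using hb 1 (by simp)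
  have hin : ∀ (x : Fin (m + 2) → ℝ) i,
      inner ℝ (b i) (b.repr.symm (WithLp.toLp 2 x)) = x i := fun x i => by
    rw [← b.repr_apply_apply, LinearIsometryEquiv.apply_symm_apply]
  refine ⟨fun x => b.repr.symm (WithLp.toLp 2 x),
    b.measurePreserving_repr_symm.comp (PiLp.volume_preserving_toLp _), fun x => ?_, fun x => ?_⟩
  · rw [LinearIsometryEquiv.norm_map, EuclideanSpace.norm_sq_eq]
    simp
  · set z := b.repr.symm (WithLp.toLp 2 x) with hz
    have hx0 : x 0 = (herm z ζ).re := by rw [re_herm_eq_inner, ← hb0, hz, hin]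
    have hx1 : x 1 = (herm z ζ).im := by
      rw [← hin x 1, hb1, ← hz, ← re_herm_eq_inner, herm_smul_right]
      simp
    rw [hx0, hx1, Complex.re_add_im]

/-- The centred nonisotropic box whose translate by `w` is the analogue of a Bergman ball. -/
def tangentBox (w : Cn n) (ε : ℝ) : Set (Cn n) :=
  {ζ | ‖ζ‖ ^ 2 < ε ^ 2 * (1 - ‖w‖ ^ 2) ∧ ‖herm ζ w‖ < ε * (1 - ‖w‖ ^ 2)}

lemma isOpen_tangentBox (w : Cn n) (ε : ℝ) : IsOpen (tangentBox w ε) := by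
  have h1 : IsOpen {ζ : Cn n | ‖ζ‖ ^ 2 < ε ^ 2 * (1 - ‖w‖ ^ 2)} :=
    isOpen_lt (by fun_prop) (by fun_prop)
  have h2 : IsOpen {ζ : Cn n | ‖herm ζ w‖ < ε * (1 - ‖w‖ ^ 2)} :=
    isOpen_lt (by fun_prop) (by fun_prop)
  exact h1.inter h2

/-- In coordinates adapted to w the box contains a product of two intervals of length of order ρ and
2n - 2 intervals of length of order √ρ, and ρ² (√ρ)^(2n-2) = ρ^(n+1). -/
lemma volume_tangentBox_ge (hn : 1 ≤ n) {ε : ℝ} (hε : 0 < ε) :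
    ∃ c : ℝ, 0 < c ∧ ∀ w ∈ unitBall n,
      ENNReal.ofReal (c * (1 - ‖w‖ ^ 2) ^ (n + 1)) ≤ volume (tangentBox w ε) := by
  refine ⟨(2 * (ε / (2 * n))) ^ (2 * n), by positivity, fun w hw => ?_⟩
  obtain ⟨ζ, hζ, hwζ⟩ := exists_unit_direction hn w
  obtain ⟨m, hm, T, hT, hTn, hTh⟩ := exists_orthonormal_coordinates hn hζ
  have hw1 : ‖w‖ ≤ 1 := (mem_unitBall.1 hw).le
  set ρ := 1 - ‖w‖ ^ 2 with hρ
  have hρ0 : 0 < ρ := one_sub_norm_sq_pos hw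
  have hρ1 : ρ ≤ 1 := by nlinarith [sq_nonneg ‖w‖]
  have hρs : ρ ≤ √ρ := by
    refine le_sqrt_of_sq_le ?_
    nlinarith
  rw [← hT.measure_preimage (isOpen_tangentBox w ε).nullMeasurableSet]
  set N : ℝ := 2 * n with hN
  have hNm : N = m + 2 := by rw [hN]; exact_mod_cast hm.symm
  have hN2 : 2 ≤ N := by rw [hNm]; linarith [(Nat.cast_nonneg m : (0 : ℝ) ≤ m)]
  -- Division by N = 2n leaves room for the sum of 2n squares in the norm condition and for the two
  -- terms of ⟨ζ, w⟩.
  let c : Fin (m + 2) → ℝ := Fin.cons (ε / N * ρ) (Fin.cons (ε / N * ρ) fun _ => ε / N * √ρ)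
  have hc0 : c 0 = ε / N * ρ := rfl
  have hc1 : c 1 = ε / N * ρ := rfl
  have hcle : ∀ i, c i ≤ ε / N * √ρ := by
    intro i
    refine Fin.cases ?_ (fun j => Fin.cases ?_ (fun l => ?_) j) i
    · exact mul_le_mul_of_nonneg_left hρs (by positivity)
    · exact mul_le_mul_of_nonneg_left hρs (by positivity)
    · exact le_refl _
  have hsub : univ.pi (fun i => Ioo (-c i) (c i)) ⊆ T ⁻¹' tangentBox w ε := by
    intro x hx
    have hx' : ∀ i, |x i| < c i := fun i => abs_lt.2 (hx i (mem_univ i))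
    refine ⟨?_, ?_⟩
    · rw [hTn]
      have h1 : ∀ i, x i ^ 2 ≤ (ε / N) ^ 2 * ρ := fun i => by
        have h := (hx' i).le.trans (hcle i)
        calc x i ^ 2 = |x i| ^ 2 := (sq_abs _).symm
          _ ≤ (ε / N * √ρ) ^ 2 := by gcongr
          _ = (ε / N) ^ 2 * ρ := by rw [mul_pow, sq_sqrt hρ0.le]
      calc ∑ i, x i ^ 2 ≤ ∑ _i : Fin (m + 2), (ε / N) ^ 2 * ρ := Finset.sum_le_sum fun i _ => h1 i
        _ = N * ((ε / N) ^ 2 * ρ) := by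
          rw [Finset.sum_const, Finset.card_univ, Fintype.card_fin, nsmul_eq_mul, hNm]
          push_cast; ring
        _ = ε ^ 2 * ρ / N := by field_simp
        _ < ε ^ 2 * ρ := div_lt_self (by positivity) (by linarith)
    · have hwh : herm (T x) w = ‖w‖ * herm (T x) ζ := by
        conv_lhs => rw [hwζ]
        rw [herm_real_smul_right]
      rw [hwh, norm_mul, Complex.norm_real, norm_norm, hTh]
      have h1 := hx' 0
      have h2 := hx' 1
      rw [hc0] at h1
      rw [hc1] at h2
      have h3 : ‖(x 0 : ℂ) + x 1 * Complex.I‖ < ε * ρ := by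
        calc ‖(x 0 : ℂ) + x 1 * Complex.I‖ ≤ |x 0| + |x 1| := by
              refine (norm_add_le _ _).trans (le_of_eq ?_)
              rw [norm_mul, Complex.norm_I, mul_one, Complex.norm_real, Complex.norm_real,
                norm_eq_abs, norm_eq_abs]
          _ < ε / N * ρ + ε / N * ρ := add_lt_add h1 h2
          _ = ε * ρ * (2 / N) := by ring
          _ ≤ ε * ρ * 1 := by
            gcongr
            rw [div_le_one (by linarith)]
            exact hN2
          _ = ε * ρ := mul_one _
      calc ‖w‖ * ‖(x 0 : ℂ) + x 1 * Complex.I‖ ≤ 1 * ‖(x 0 : ℂ) + x 1 * Complex.I‖ := by gcongr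
        _ < ε * ρ := by rwa [one_mul]
  refine le_trans (le_of_eq ?_) (measure_mono hsub)
  rw [Real.volume_pi_Ioo, ← ENNReal.ofReal_prod_of_nonneg]
  · congr 1
    have h1 : ∀ i, c i - -c i = 2 * c i := fun i => by ring
    simp only [h1, Finset.prod_mul_distrib, Finset.prod_const, Finset.card_univ, Fintype.card_fin]
    rw [Fin.prod_univ_succ, Fin.prod_univ_succ]
    simp only [c, Fin.cons_zero, Fin.cons_succ, Finset.prod_const, Finset.card_univ,
      Fintype.card_fin, mul_pow]
    have hm' : m = 2 * (n - 1) := by omega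
    obtain ⟨k, rfl⟩ : ∃ k, n = k + 1 := ⟨n - 1, by omega⟩
    obtain rfl : m = 2 * k := by omega
    rw [pow_mul (√ρ), sq_sqrt hρ0.le]
    ring
  · intro i _
    have : 0 ≤ c i := by
      refine Fin.cases ?_ (fun j => Fin.cases ?_ (fun l => ?_) j) i
      · exact (by positivity : 0 ≤ ε / N * ρ)
      · exact (by positivity : 0 ≤ ε / N * ρ)
      · exact (by positivity : 0 ≤ ε / N * √ρ)
    linarith

/-- With a = √(1 - c), the weight factors as (a + x)^t (a - x)^t. Since 1 ≤ a + x ≤ 2, the first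
factor is at most 2^|t| even for negative t, and the second integrates to at most r^(t+1)/(t+1)
because a ≤ 1. This is the integral in Re ⟨z, ζ⟩ over a Carleson region. -/
lemma lintegral_one_sub_sq_rpow_le {t r c : ℝ} (ht : -1 < t) (hr2 : r ≤ 1 / 2)
    (hc : 0 ≤ c) :
    ∫⁻ x : ℝ, {x : ℝ | 1 - r < x ∧ x ^ 2 + c < 1}.indicator
        (fun x => ENNReal.ofReal ((1 - (x ^ 2 + c)) ^ t)) x ≤
      ENNReal.ofReal (2 ^ |t| / (t + 1) * r ^ (t + 1)) := by
  set a := √(1 - c) with ha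
  have ha1 : a ≤ 1 := by rw [ha, Real.sqrt_le_one]; linarith
  have ht1 : 0 < t + 1 := by linarith
  have hpt : ∀ x : ℝ, {x : ℝ | 1 - r < x ∧ x ^ 2 + c < 1}.indicator
      (fun x => ENNReal.ofReal ((1 - (x ^ 2 + c)) ^ t)) x ≤
      (Ioc (1 - r) a).indicator (fun x => ENNReal.ofReal (2 ^ |t| * (a - x) ^ t)) x := by
    refine indicator_le fun x ⟨hx1, hx2⟩ => ?_
    have hxa : x < a := lt_sqrt_of_sq_lt (by linarith)
    rw [indicator_of_mem (show x ∈ Ioc (1 - r) a from ⟨hx1, hxa.le⟩)]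
    refine ENNReal.ofReal_le_ofReal ?_
    have h1c : 0 ≤ 1 - c := by nlinarith [sq_nonneg x]
    have hfac : 1 - (x ^ 2 + c) = (a + x) * (a - x) := by
      have := sq_sqrt h1c
      rw [← ha] at this
      linear_combination -this
    rw [hfac, mul_rpow (by linarith) (by linarith)]
    refine mul_le_mul_of_nonneg_right ?_ (rpow_nonneg (by linarith) _)
    calc (a + x) ^ t ≤ (a + x) ^ |t| :=
          rpow_le_rpow_of_exponent_le (by linarith) (le_abs_self t)
      _ ≤ 2 ^ |t| := rpow_le_rpow (by linarith) (by linarith) (abs_nonneg t)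
  refine (lintegral_mono hpt).trans ?_
  rw [lintegral_indicator measurableSet_Ioc]
  rcases le_or_gt a (1 - r) with har | har
  · rw [Ioc_eq_empty (not_lt.2 har), Measure.restrict_empty, lintegral_zero_measure]
    exact zero_le
  have hint : IntervalIntegrable (fun x => 2 ^ |t| * (a - x) ^ t) volume (1 - r) a := by
    have h := (intervalIntegral.intervalIntegrable_rpow' (a := a - (1 - r)) (b := a - a)
      ht).comp_sub_left a
    simpa using h.const_mul (2 ^ |t|)
  rw [← ofReal_integral_eq_lintegral_ofReal ((intervalIntegrable_iff_integrableOn_Ioc_of_le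
    har.le).1 hint)]
  · refine ENNReal.ofReal_le_ofReal ?_
    rw [← intervalIntegral.integral_of_le har.le, intervalIntegral.integral_const_mul,
      intervalIntegral.integral_comp_sub_left (fun x => x ^ t), integral_rpow (Or.inl ht), sub_self,
      zero_rpow ht1.ne', sub_zero, mul_div_assoc', div_mul_eq_mul_div]
    gcongr
    linarith
  · refine (ae_restrict_iff' measurableSet_Ioc).2 (ae_of_all _ fun x hx => ?_)
    exact mul_nonneg (by positivity) (rpow_nonneg (by linarith [hx.2]) _)

lemma weightedVolume_apply {t : ℝ} {S : Set (Cn n)} (hS : MeasurableSet S) (hSB : S ⊆ unitBall n) :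
    weightedVolume n t S = ∫⁻ z in S, ENNReal.ofReal ((1 - ‖z‖ ^ 2) ^ t) := by
  rw [weightedVolume, withDensity_apply _ hS, Measure.restrict_restrict hS,
    inter_eq_left.2 hSB]

lemma lintegral_weightedVolume {t : ℝ} (g : Cn n → ENNReal) :
    ∫⁻ z, g z ∂(weightedVolume n t) =
      ∫⁻ z in unitBall n, ENNReal.ofReal ((1 - ‖z‖ ^ 2) ^ t) * g z := by
  rw [weightedVolume, lintegral_withDensity_eq_lintegral_mul_non_measurable]
  · rfl
  · exact ((measurable_const.sub (measurable_norm.pow_const 2)).pow_const t).ennreal_ofReal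
  · exact ae_of_all _ fun _ => ENNReal.ofReal_lt_top

/-- In polar coordinates (1 - y²)^t = (1 - y)^t (1 + y)^t, and only the first factor can be
singular; it is integrable for t > -1. -/
lemma weightedVolume_univ_lt_top (hn : 1 ≤ n) {t : ℝ} (ht : -1 < t) :
    weightedVolume n t univ < ⊤ := by
  have h1 : IntegrableOn (fun y : ℝ => (1 - y) ^ t) (Icc 0 1) := by
    have h := (intervalIntegral.intervalIntegrable_rpow' (a := 1 - 0) (b := 1 - 1)
      ht).comp_sub_left 1
    simp only [sub_sub_cancel] at h
    exact (intervalIntegrable_iff_integrableOn_Icc_of_le zero_le_one).1 h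
  have hcont : ContinuousOn (fun y : ℝ => y ^ (Module.finrank ℝ (Cn n) - 1) * (1 + y) ^ t)
      (Icc 0 1) := by
    refine (continuousOn_id.pow _).mul (ContinuousOn.rpow_const (by fun_prop) fun y hy => ?_)
    exact Or.inl (by linarith [hy.1])
  have h2 := (h1.mul_continuousOn hcont isCompact_Icc).mono_set Ioo_subset_Icc_self
  have : Nontrivial (Cn n) := by
    have : Nonempty (Fin n) := ⟨⟨0, hn⟩⟩
    infer_instance
  have h3 : IntegrableOn (fun z : Cn n => (1 - ‖z‖ ^ 2) ^ t) (ball 0 1) := by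
    refine (integrableOn_fun_norm_addHaar (μ := volume) (f := fun y => (1 - y ^ 2) ^ t)).2 ?_
    refine h2.congr_fun (fun y hy => ?_) measurableSet_Ioo
    have : (1 - y ^ 2) ^ t = (1 - y) ^ t * (1 + y) ^ t := by
      rw [← mul_rpow (by linarith [hy.2]) (by linarith [hy.1])]
      congr 1; ring
    simp only [smul_eq_mul, this]
    ring
  rw [weightedVolume, withDensity_apply _ MeasurableSet.univ, Measure.restrict_univ]
  refine lt_of_le_of_lt (lintegral_mono fun z => ?_) h3.2
  rw [← ofReal_norm]
  exact ENNReal.ofReal_le_ofReal (le_abs_self _)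

lemma isOpen_carlesonRegion (r : ℝ) (ζ : Cn n) : IsOpen (carlesonRegion r ζ) := by
  have h2 : IsOpen {z : Cn n | ‖1 - herm z ζ‖ < r} := isOpen_lt (by fun_prop) (by fun_prop)
  exact isOpen_unitBall.inter h2

lemma carlesonRegion_subset (r : ℝ) (ζ : Cn n) : carlesonRegion r ζ ⊆ unitBall n :=
  fun _ hz => hz.1

/-- Thin Carleson regions have the expected weighted volume. -/
lemma weightedVolume_carlesonRegion_le_of_le_half (hn : 1 ≤ n) {t : ℝ} (ht : -1 < t) :
    ∃ C : ℝ, 0 < C ∧ ∀ r : ℝ, 0 < r → r ≤ 1 / 2 → ∀ ζ : Cn n, ‖ζ‖ = 1 →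
      weightedVolume n t (carlesonRegion r ζ) ≤ ENNReal.ofReal (C * r ^ (n + 1 + t)) := by
  have ht1 : 0 < t + 1 := by linarith
  refine ⟨2 ^ |t| / (t + 1) * (2 ^ (2 * n - 1) * 2 ^ (n - 1)), by positivity,
    fun r hr hr2 ζ hζ => ?_⟩
  obtain ⟨m, hm, T, hT, hTn, hTh⟩ := exists_orthonormal_coordinates hn hζ
  have hQm := (isOpen_carlesonRegion r ζ).measurableSet
  -- Half-sides of a box for the coordinates other than Re ⟨z, ζ⟩: the imaginary part is below r,
  -- and every other coordinate has square below 1 - (1 - r)² ≤ 2r.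
  let d : Fin (m + 1) → ℝ := Fin.cons r fun _ => √(2 * r)
  have hd0 : ∀ i, 0 ≤ d i := by
    intro i
    refine Fin.cases ?_ (fun l => ?_) i
    · exact hr.le
    · exact sqrt_nonneg _
  let Box : Set (Fin (m + 1) → ℝ) := univ.pi fun i => Ioo (-d i) (d i)
  have hBox : MeasurableSet Box := MeasurableSet.univ_pi fun _ => measurableSet_Ioo
  let S : Set (ℝ × (Fin (m + 1) → ℝ)) :=
    {x | x.2 ∈ Box ∧ 1 - r < x.1 ∧ x.1 ^ 2 + ∑ i, x.2 i ^ 2 < 1}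
  have hS : MeasurableSet S := by
    have h1 : MeasurableSet {x : ℝ × (Fin (m + 1) → ℝ) | 1 - r < x.1} :=
      measurableSet_lt measurable_const measurable_fst
    have h2 : MeasurableSet {x : ℝ × (Fin (m + 1) → ℝ) | x.1 ^ 2 + ∑ i, x.2 i ^ 2 < 1} :=
      measurableSet_lt (by fun_prop) measurable_const
    exact (measurable_snd hBox).inter (h1.inter h2)
  let G : ℝ × (Fin (m + 1) → ℝ) → ENNReal :=
    S.indicator fun x => ENNReal.ofReal ((1 - (x.1 ^ 2 + ∑ i, x.2 i ^ 2)) ^ t)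
  have hG : Measurable G := by
    refine Measurable.indicator (Measurable.ennreal_ofReal (Measurable.pow_const ?_ t)) hS
    fun_prop
  have hpt : ∀ x : Fin (m + 2) → ℝ,
      (carlesonRegion r ζ).indicator (fun z => ENNReal.ofReal ((1 - ‖z‖ ^ 2) ^ t)) (T x) ≤
      G (MeasurableEquiv.piFinSuccAbove (fun _ => ℝ) 0 x) := by
    intro x
    by_cases hx : T x ∈ carlesonRegion r ζ
    · have hsum : ‖T x‖ ^ 2 = x 0 ^ 2 + ∑ i : Fin (m + 1), x i.succ ^ 2 := by
        rw [hTn, Fin.sum_univ_succ]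
      have hlt : ‖T x‖ ^ 2 < 1 := by linarith [one_sub_norm_sq_pos hx.1]
      have hre : 1 - r < x 0 := by
        have h := (Complex.re_le_norm (1 - herm (T x) ζ)).trans_lt hx.2
        rw [hTh] at h
        simp at h
        linarith
      have him : |x 1| < r := by
        have h := (Complex.abs_im_le_norm (1 - herm (T x) ζ)).trans_lt hx.2
        rw [hTh] at h
        simpa using h
      have hxS : ((MeasurableEquiv.piFinSuccAbove (fun _ => ℝ) 0 x) :
          ℝ × (Fin (m + 1) → ℝ)) ∈ S := by
        refine ⟨fun i _ => ?_, hre, ?_⟩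
        · rw [mem_Ioo, ← abs_lt]
          refine Fin.cases ?_ (fun l => ?_) i
          · exact him
          · show |x l.succ.succ| < √(2 * r)
            refine lt_sqrt_of_sq_lt ?_
            rw [sq_abs]
            have h1 : x l.succ.succ ^ 2 ≤ ∑ i : Fin (m + 1), x i.succ ^ 2 :=
              Finset.single_le_sum (f := fun i : Fin (m + 1) => x i.succ ^ 2)
                (fun i _ => sq_nonneg _) (Finset.mem_univ l.succ)
            nlinarith
        · rw [hsum] at hlt
          exact hlt
      rw [indicator_of_mem hx, show G _ = _ from indicator_of_mem hxS _, hsum]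
      exact le_refl _
    · rw [indicator_of_notMem hx]
      exact zero_le
  rw [weightedVolume_apply hQm (carlesonRegion_subset r ζ), ← lintegral_indicator hQm,
    ← hT.lintegral_comp (Measurable.indicator (by fun_prop) hQm)]
  refine (lintegral_mono hpt).trans ?_
  rw [(volume_preserving_piFinSuccAbove (fun _ : Fin (m + 2) => ℝ) 0).lintegral_comp hG,
    Measure.volume_eq_prod, lintegral_prod_symm' _ hG]
  have hinner : ∀ y : Fin (m + 1) → ℝ, ∫⁻ x, G (x, y) ≤
      Box.indicator (fun _ => ENNReal.ofReal (2 ^ |t| / (t + 1) * r ^ (t + 1))) y := by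
    intro y
    by_cases hy : y ∈ Box
    · rw [indicator_of_mem hy]
      refine le_trans (le_of_eq (lintegral_congr fun x => ?_))
        (lintegral_one_sub_sq_rpow_le (c := ∑ i, y i ^ 2) ht hr2
          (Finset.sum_nonneg fun i _ => sq_nonneg (y i)))
      simp [G, S, indicator, hy]
    · rw [indicator_of_notMem hy]
      refine le_of_eq (lintegral_eq_zero_of_ae_eq_zero (ae_of_all _ fun x => ?_))
      exact indicator_of_notMem (fun h => hy h.1) _
  refine (lintegral_mono hinner).trans (le_of_eq ?_)
  rw [lintegral_indicator hBox, setLIntegral_const, Real.volume_pi_Ioo,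
    ← ENNReal.ofReal_prod_of_nonneg fun i _ => by linarith [hd0 i],
    ← ENNReal.ofReal_mul (by positivity)]
  congr 1
  have h1 : ∀ i, d i - -d i = 2 * d i := fun i => by ring
  simp only [h1, Finset.prod_mul_distrib, Finset.prod_const, Finset.card_univ, Fintype.card_fin]
  rw [Fin.prod_univ_succ]
  simp only [d, Fin.cons_zero, Fin.cons_succ, Finset.prod_const, Finset.card_univ,
    Fintype.card_fin]
  obtain ⟨k, rfl⟩ : ∃ k, n = k + 1 := ⟨n - 1, by omega⟩
  obtain rfl : m = 2 * k := by omega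
  have hexp : r ^ ((k + 1 : ℕ) + 1 + t : ℝ) = r ^ (t + 1) * (r * r ^ k) := by
    rw [← pow_succ', ← rpow_natCast, ← rpow_add hr]
    congr 1; push_cast; ring
  rw [hexp, pow_mul (√(2 * r)), sq_sqrt (by positivity), mul_pow,
    show 2 * (k + 1) - 1 = 2 * k + 1 by omega, Nat.add_sub_cancel]
  ring

/-- The measure `v_t` is a Carleson measure of order `n + 1 + t`. -/
lemma exists_weightedVolume_carlesonRegion_le (hn : 1 ≤ n) {t : ℝ} (ht : -1 < t) :
    ∃ C : ℝ, 0 < C ∧ ∀ r : ℝ, 0 < r → ∀ ζ : Cn n, ‖ζ‖ = 1 →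
      weightedVolume n t (carlesonRegion r ζ) ≤ ENNReal.ofReal (C * r ^ (n + 1 + t)) := by
  obtain ⟨C, hC, h⟩ := weightedVolume_carlesonRegion_le_of_le_half hn ht
  have hfin := weightedVolume_univ_lt_top hn ht
  set V := (weightedVolume n t univ).toReal
  have he : (0 : ℝ) < n + 1 + t := by
    have : (0 : ℝ) ≤ n := n.cast_nonneg
    linarith
  -- The second summand covers r > 1/2, where the total mass V is a sufficient bound.
  refine ⟨C + V / (1 / 2) ^ (n + 1 + t), by positivity, fun r hr ζ hζ => ?_⟩
  rcases le_or_gt r (1 / 2) with hr2 | hr2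
  · refine (h r hr hr2 ζ hζ).trans (ENNReal.ofReal_le_ofReal ?_)
    gcongr
    exact le_add_of_nonneg_right (by positivity)
  · refine (measure_mono (subset_univ _)).trans ?_
    rw [← ENNReal.ofReal_toReal hfin.ne]
    refine ENNReal.ofReal_le_ofReal ?_
    calc V = V / (1 / 2) ^ (n + 1 + t) * (1 / 2) ^ (n + 1 + t) := by
          field_simp
      _ ≤ (C + V / (1 / 2) ^ (n + 1 + t)) * r ^ (n + 1 + t) := by
        gcongr
        exact le_add_of_nonneg_left hC.le

/-! ### Carleson regions and Berezin-type integrals -/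

/-- `μ` is a Carleson measure of order `d`. -/
def CarlesonBounded (μ : Measure (Cn n)) (d : ℝ) : Prop :=
  ∃ C : ℝ, 0 < C ∧ ∀ r : ℝ, 0 < r → ∀ ζ ∈ unitSphere n,
    μ (carlesonRegion r ζ) ≤ ENNReal.ofReal (C * r ^ d)

lemma mem_unitSphere {ζ : Cn n} : ζ ∈ unitSphere n ↔ ‖ζ‖ = 1 := mem_sphere_zero_iff_norm

lemma one_sub_norm_le_norm_one_sub_herm {w z : Cn n} (hw : w ∈ unitBall n) :
    1 - ‖z‖ ≤ ‖1 - herm w z‖ := by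
  have h1 := norm_sub_norm_le (1 : ℂ) (herm w z)
  have h2 := norm_herm_le w z
  rw [norm_one] at h1
  have h3 := mem_unitBall.1 hw
  nlinarith [norm_nonneg z]

lemma norm_one_sub_herm_pos {w z : Cn n} (hw : w ∈ unitBall n) (hz : z ∈ unitBall n) :
    0 < ‖1 - herm w z‖ :=
  lt_of_lt_of_le (sub_pos.2 (mem_unitBall.1 hz)) (one_sub_norm_le_norm_one_sub_herm hw)

lemma one_sub_norm_sq_le (z : Cn n) : 1 - ‖z‖ ^ 2 ≤ 2 * (1 - ‖z‖) := by
  nlinarith [sq_nonneg (1 - ‖z‖)]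

/-- Replacing `z` by its radial projection on the sphere at most doubles `|1 - ⟨w, z⟩|`. -/
lemma norm_one_sub_herm_direction_le {w z ζ : Cn n} (hw : w ∈ unitBall n) (hz : z ∈ unitBall n)
    (hζ : ‖ζ‖ = 1) (hzζ : z = ‖z‖ • ζ) : ‖1 - herm w ζ‖ ≤ 2 * ‖1 - herm w z‖ := by
  have h1 : herm w z = ‖z‖ * herm w ζ := by
    conv_lhs => rw [hzζ]
    rw [herm_real_smul_right]
  have h2 : 1 - herm w ζ = (1 - herm w z) - ((1 - ‖z‖ : ℝ) : ℂ) * herm w ζ := by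
    rw [h1]; push_cast; ring
  have h3 := norm_herm_le w ζ
  rw [hζ, mul_one] at h3
  have hz1 := mem_unitBall.1 hz
  have hw1 := mem_unitBall.1 hw
  rw [h2]
  refine (norm_sub_le _ _).trans ?_
  rw [norm_mul, Complex.norm_real, norm_eq_abs, abs_of_pos (by linarith)]
  have h4 := one_sub_norm_le_norm_one_sub_herm (z := z) hw
  nlinarith [norm_nonneg (herm w ζ)]

lemma const_mul_measure_le_setLIntegral {μ : Measure (Cn n)} {S : Set (Cn n)}
    (hS : MeasurableSet S) (hSB : S ⊆ unitBall n) {c : ENNReal} {g : Cn n → ENNReal}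
    (h : ∀ w ∈ S, c ≤ g w) : c * μ S ≤ ∫⁻ w in unitBall n, g w ∂μ := by
  rw [← setLIntegral_const]
  exact (setLIntegral_mono' hS h).trans (lintegral_mono_set hSB)

/-- Split the ball into shells 2^k δ ≤ |1 - ⟨w, z⟩| < 2^(k+1) δ with δ = 1 - |z|. Each shell lies in
a Carleson region of comparable radius, so its contribution is O(2^(-ks)), and the geometric series
converges because s > 0. -/
lemma berezinBounded_of_carlesonBounded (hn : 1 ≤ n) {μ : Measure (Cn n)} {d s : ℝ} (hd : 0 < d)
    (hs : 0 < s) (h : CarlesonBounded μ d) : BerezinBounded μ d s := by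
  obtain ⟨C, hC, h⟩ := h
  have hq0 : (0 : ℝ) ≤ (1 / 2) ^ s := by positivity
  have hq1 : (1 / 2 : ℝ) ^ s < 1 := rpow_lt_one (by norm_num) (by norm_num) hs
  set K : ℝ := 2 ^ s * C * 4 ^ d with hK
  have hK0 : 0 < K := by positivity
  refine ⟨K * (1 - (1 / 2) ^ s)⁻¹, mul_pos hK0 (inv_pos.2 (sub_pos.2 hq1)), fun z hz => ?_⟩
  obtain ⟨ζ, hζ, hzζ⟩ := exists_unit_direction hn z
  set δ := 1 - ‖z‖ with hδ
  have hδ0 : 0 < δ := sub_pos.2 (mem_unitBall.1 hz)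
  have hρ0 := one_sub_norm_sq_pos hz
  have hρδ := one_sub_norm_sq_le z
  set ρ := 1 - ‖z‖ ^ 2
  let A : ℕ → ENNReal := fun k => ENNReal.ofReal (ρ ^ s / (2 ^ k * δ) ^ (s + d))
  -- The factor 4 is 2 for the outer edge of the shell times 2 for replacing z by its direction ζ.
  let Q : ℕ → Set (Cn n) := fun k => carlesonRegion (4 * (2 ^ k * δ)) ζ
  have hQ : ∀ k, MeasurableSet (Q k) := fun k => (isOpen_carlesonRegion _ _).measurableSet
  have hpt : ∀ w ∈ unitBall n, ENNReal.ofReal (ρ ^ s / ‖1 - herm z w‖ ^ (s + d)) ≤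
      ∑' k, A k * (Q k).indicator 1 w := by
    intro w hw
    rw [norm_one_sub_herm_comm]
    have h1 : δ ≤ ‖1 - herm w z‖ := one_sub_norm_le_norm_one_sub_herm hw
    have h2 := norm_one_sub_herm_direction_le hw hz hζ hzζ
    obtain ⟨k, hk1, hk2⟩ := exists_nat_pow_near ((one_le_div hδ0).2 h1) one_lt_two
    rw [le_div_iff₀ hδ0] at hk1
    rw [div_lt_iff₀ hδ0, pow_succ] at hk2
    have hwQ : w ∈ Q k := ⟨hw, by linarith⟩
    refine le_trans ?_ (ENNReal.le_tsum k)
    rw [indicator_of_mem hwQ, Pi.one_apply, mul_one]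
    refine ENNReal.ofReal_le_ofReal ?_
    gcongr
  calc ∫⁻ w in unitBall n, ENNReal.ofReal (ρ ^ s / ‖1 - herm z w‖ ^ (s + d)) ∂μ
      ≤ ∫⁻ w in unitBall n, ∑' k, A k * (Q k).indicator 1 w ∂μ :=
        setLIntegral_mono' measurableSet_unitBall hpt
    _ ≤ ∫⁻ w, ∑' k, A k * (Q k).indicator 1 w ∂μ := setLIntegral_le_lintegral _ _
    _ = ∑' k, A k * μ (Q k) := by
      rw [lintegral_tsum fun k =>
        ((measurable_one.indicator (hQ k)).const_mul _).aemeasurable]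
      refine tsum_congr fun k => ?_
      rw [lintegral_const_mul _ (measurable_one.indicator (hQ k)), lintegral_indicator_one (hQ k)]
    _ ≤ ∑' k, ENNReal.ofReal (K * ((1 / 2) ^ s) ^ k) := by
      refine ENNReal.tsum_le_tsum fun k => ?_
      have hx : 0 < 2 ^ k * δ := by positivity
      refine (mul_le_mul_right (h _ (by positivity) ζ (mem_unitSphere.2 hζ)) _).trans ?_
      rw [← ENNReal.ofReal_mul (by positivity)]
      refine ENNReal.ofReal_le_ofReal ?_
      have e1 : ((1 / 2 : ℝ) ^ s) ^ k = δ ^ s / (2 ^ k * δ) ^ s := by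
        rw [← div_rpow hδ0.le hx.le, ← rpow_natCast, ← rpow_mul (by norm_num), mul_comm,
          rpow_mul (by norm_num), rpow_natCast]
        congr 1
        field_simp
        rw [← mul_pow]
        norm_num
      calc ρ ^ s / (2 ^ k * δ) ^ (s + d) * (C * (4 * (2 ^ k * δ)) ^ d)
          ≤ (2 * δ) ^ s / (2 ^ k * δ) ^ (s + d) * (C * (4 * (2 ^ k * δ)) ^ d) := by gcongr
        _ = K * ((1 / 2) ^ s) ^ k := by
          rw [e1, rpow_add hx, mul_rpow zero_le_four hx.le, mul_rpow zero_le_two hδ0.le, hK]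
          field_simp
    _ = ENNReal.ofReal (K * (1 - (1 / 2) ^ s)⁻¹) := by
      rw [← ENNReal.ofReal_tsum_of_nonneg (fun k => by positivity)
        ((summable_geometric_of_lt_one hq0 hq1).mul_left K), tsum_mul_left,
        tsum_geometric_of_lt_one hq0 hq1]

/-- On a Carleson region of radius `r` about `ζ`, the kernel at `(1 - r) ζ` is large. -/
lemma norm_one_sub_herm_radial_lt {r : ℝ} (hr : 0 < r) {ζ w : Cn n} (hζ : ‖ζ‖ = 1)
    (hw : w ∈ carlesonRegion r ζ) : ‖1 - herm w ((1 - r) • ζ)‖ < 2 * r := by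
  have h1 : 1 - herm w ((1 - r) • ζ) = (1 - herm w ζ) + r * herm w ζ := by
    rw [herm_real_smul_right]; push_cast; ring
  have h3 := norm_herm_le w ζ
  rw [hζ, mul_one] at h3
  have hw1 := mem_unitBall.1 hw.1
  have hw2 := hw.2
  rw [h1]
  refine lt_of_le_of_lt (norm_add_le _ _) ?_
  rw [norm_mul, Complex.norm_real, norm_eq_abs, abs_of_pos hr]
  nlinarith

lemma norm_radial {r : ℝ} (hr1 : r < 1) {ζ : Cn n} (hζ : ‖ζ‖ = 1) :
    ‖(1 - r) • ζ‖ = 1 - r := by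
  rw [norm_smul, hζ, mul_one, norm_eq_abs, abs_of_pos (by linarith)]

/-- At z = (1 - r) ζ the kernel is at least r^s / (2r)^(s+d) on Q_r(ζ). For r ≥ 1 this point is
unavailable; at z = 0 the kernel is 1, which bounds the total mass. -/
lemma carlesonBounded_of_berezinBounded {μ : Measure (Cn n)} {d s : ℝ} (hd : 0 < d)
    (hs : 0 < s) (h : BerezinBounded μ d s) : CarlesonBounded μ d := by
  obtain ⟨C, hC, h⟩ := h
  refine ⟨2 ^ (s + d) * C, by positivity, fun r hr ζ hζ => ?_⟩
  rw [mem_unitSphere] at hζ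
  have hQ := (isOpen_carlesonRegion r ζ).measurableSet
  rcases lt_or_ge r 1 with hr1 | hr1
  · have hz : (1 - r) • ζ ∈ unitBall n := by
      rw [mem_unitBall, norm_radial hr1 hζ]; linarith
    have h1 := h _ hz
    rw [norm_radial hr1 hζ] at h1
    have h2 : ENNReal.ofReal (r ^ s / (2 * r) ^ (s + d)) * μ (carlesonRegion r ζ) ≤
        ENNReal.ofReal C := by
      refine (const_mul_measure_le_setLIntegral hQ (carlesonRegion_subset r ζ)
        fun w hw => ?_).trans h1
      refine ENNReal.ofReal_le_ofReal ?_
      rw [norm_one_sub_herm_comm]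
      have h3 := (norm_one_sub_herm_radial_lt hr hζ hw).le
      have h4 := norm_one_sub_herm_pos hw.1 hz
      have h5 : r ≤ 1 - (1 - r) ^ 2 := by nlinarith
      have h6 : 0 ≤ (1 - (1 - r) ^ 2) ^ s := rpow_nonneg (hr.le.trans h5) s
      gcongr
    have hpos : 0 < r ^ s / (2 * r) ^ (s + d) := by positivity
    rw [mul_comm, ← ENNReal.le_div_iff_mul_le (Or.inl (by simpa using hpos))
      (Or.inl ENNReal.ofReal_ne_top), ← ENNReal.ofReal_div_of_pos hpos] at h2
    refine h2.trans (le_of_eq (congrArg _ ?_))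
    rw [mul_rpow zero_le_two hr.le, rpow_add hr]
    field_simp
  · have h1 := h 0 (by simp [mem_unitBall])
    have h2 : 1 * μ (carlesonRegion r ζ) ≤ ENNReal.ofReal C := by
      refine (const_mul_measure_le_setLIntegral hQ (carlesonRegion_subset r ζ)
        fun w hw => ?_).trans h1
      simp [herm]
    rw [one_mul] at h2
    refine h2.trans (ENNReal.ofReal_le_ofReal ?_)
    have h3 : (1 : ℝ) ≤ 2 ^ (s + d) := one_le_rpow one_le_two (by linarith)
    have h4 : (1 : ℝ) ≤ r ^ d := one_le_rpow hr1 hd.le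
    calc C = 1 * C * 1 := by ring
      _ ≤ 2 ^ (s + d) * C * r ^ d := by gcongr

/-- The Forelli–Rudin estimate. -/
lemma exists_lintegral_kernel_le (hn : 1 ≤ n) {t σ : ℝ} (ht : -1 < t) (hσ : n + 1 + t < σ) :
    ∃ C : ℝ, 0 < C ∧ ∀ a ∈ unitBall n,
      ∫⁻ w in unitBall n, ENNReal.ofReal ((1 - ‖w‖ ^ 2) ^ t / ‖1 - herm w a‖ ^ σ) ≤
        ENNReal.ofReal (C * (1 - ‖a‖ ^ 2) ^ (n + 1 + t - σ)) := by
  have hd : (0 : ℝ) < n + 1 + t := by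
    have : (0 : ℝ) ≤ n := n.cast_nonneg
    linarith
  obtain ⟨C₀, hC₀, h₀⟩ := exists_weightedVolume_carlesonRegion_le hn ht
  -- The estimate is the Berezin bound for the Carleson measure v_t of order n + 1 + t, with s = σ -
  -- (n + 1 + t).
  obtain ⟨C, hC, h⟩ := berezinBounded_of_carlesonBounded hn hd (sub_pos.2 hσ)
    ⟨C₀, hC₀, fun r hr ζ hζ => h₀ r hr ζ (mem_unitSphere.1 hζ)⟩
  refine ⟨C, hC, fun a ha => ?_⟩
  have hρ := one_sub_norm_sq_pos ha
  set ρ := 1 - ‖a‖ ^ 2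
  have h1 := h a ha
  rw [sub_add_cancel, ← lintegral_indicator measurableSet_unitBall, lintegral_weightedVolume] at h1
  have h2 : ∫⁻ w in unitBall n, ENNReal.ofReal ((1 - ‖w‖ ^ 2) ^ t / ‖1 - herm w a‖ ^ σ) =
      ENNReal.ofReal (ρ ^ (n + 1 + t - σ)) * ∫⁻ w in unitBall n,
        ENNReal.ofReal ((1 - ‖w‖ ^ 2) ^ t) * (unitBall n).indicator
        (fun w => ENNReal.ofReal (ρ ^ (σ - (n + 1 + t)) / ‖1 - herm a w‖ ^ σ)) w := by
    rw [← lintegral_const_mul' _ _ ENNReal.ofReal_ne_top]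
    refine setLIntegral_congr_fun measurableSet_unitBall fun w hw => ?_
    have hw' := one_sub_norm_sq_pos hw
    rw [indicator_of_mem hw, ← ENNReal.ofReal_mul (by positivity),
      ← ENNReal.ofReal_mul (by positivity), norm_one_sub_herm_comm w a]
    congr 1
    have e : ρ ^ (n + 1 + t - σ) * ρ ^ (σ - (n + 1 + t)) = 1 := by
      rw [← rpow_add hρ]; simp
    calc (1 - ‖w‖ ^ 2) ^ t / ‖1 - herm a w‖ ^ σ
        = (ρ ^ (n + 1 + t - σ) * ρ ^ (σ - (n + 1 + t))) *
          ((1 - ‖w‖ ^ 2) ^ t / ‖1 - herm a w‖ ^ σ) := by rw [e, one_mul]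
      _ = _ := by ring
  rw [h2, mul_comm C, ENNReal.ofReal_mul (by positivity)]
  exact mul_le_mul_right h1 _

/-! ### Pointwise estimates on boxes -/

/-- The nonisotropic box about `w`, an analogue of a Bergman ball. -/
def boxRegion (w : Cn n) (ε : ℝ) : Set (Cn n) := {z | z - w ∈ tangentBox w ε}

/-- The basic estimate for points of a box region. -/
lemma abs_norm_sq_sub_le {w u : Cn n} {ε : ℝ} (hw : w ∈ unitBall n) (hε : ε ≤ 1 / 8)
    (hε0 : 0 < ε) (hu : u ∈ tangentBox w ε) :
    |‖w + u‖ ^ 2 - ‖w‖ ^ 2| ≤ (1 - ‖w‖ ^ 2) / 2 := by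
  have hρ := one_sub_norm_sq_pos hw
  have h1 : ‖w + u‖ ^ 2 - ‖w‖ ^ 2 = 2 * (herm u w).re + ‖u‖ ^ 2 := by
    rw [norm_add_sq_real, ← re_herm_eq_inner]; ring
  have h2 := (Complex.abs_re_le_norm (herm u w)).trans_lt hu.2
  have h3 := hu.1
  have h4 := sq_nonneg ‖u‖
  rw [h1]
  rw [abs_lt] at h2
  have h5 : ε * (1 - ‖w‖ ^ 2) ≤ 1 / 8 * (1 - ‖w‖ ^ 2) := by gcongr
  have h6 : ε ^ 2 * (1 - ‖w‖ ^ 2) ≤ (1 / 8) ^ 2 * (1 - ‖w‖ ^ 2) := by gcongr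
  rw [abs_le]
  constructor <;> nlinarith

lemma one_sub_norm_sq_of_mem_tangentBox {w u : Cn n} {ε : ℝ} (hw : w ∈ unitBall n)
    (hε : ε ≤ 1 / 8) (hε0 : 0 < ε) (hu : u ∈ tangentBox w ε) :
    (1 - ‖w‖ ^ 2) / 2 ≤ 1 - ‖w + u‖ ^ 2 ∧ 1 - ‖w + u‖ ^ 2 ≤ 2 * (1 - ‖w‖ ^ 2) := by
  have h := abs_le.1 (abs_norm_sq_sub_le hw hε hε0 hu)
  have hρ := one_sub_norm_sq_pos hw
  constructor <;> linarith

lemma add_mem_unitBall {w u : Cn n} {ε : ℝ} (hw : w ∈ unitBall n)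
    (hε : ε ≤ 1 / 8) (hε0 : 0 < ε) (hu : u ∈ tangentBox w ε) : w + u ∈ unitBall n := by
  have h := (one_sub_norm_sq_of_mem_tangentBox hw hε hε0 hu).1
  have hρ := one_sub_norm_sq_pos hw
  rw [mem_unitBall]
  by_contra! h1
  nlinarith

lemma smul_mem_tangentBox {w u : Cn n} {ε : ℝ} (hu : u ∈ tangentBox w ε) {l : ℂ} (hl : ‖l‖ ≤ 1) :
    l • u ∈ tangentBox w ε := by
  refine ⟨lt_of_le_of_lt ?_ hu.1, lt_of_le_of_lt ?_ hu.2⟩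
  · rw [norm_smul, mul_pow]
    exact mul_le_of_le_one_left (sq_nonneg _) (pow_le_one₀ (norm_nonneg _) hl)
  · rw [herm_smul_left, norm_mul]
    exact mul_le_of_le_one_left (norm_nonneg _) hl

lemma mem_unitBall_of_mem_boxRegion {w z : Cn n} {ε : ℝ} (hw : w ∈ unitBall n)
    (hε : ε ≤ 1 / 8) (hε0 : 0 < ε) (hz : z ∈ boxRegion w ε) : z ∈ unitBall n := by
  have h := add_mem_unitBall hw hε hε0 hz
  rwa [add_sub_cancel] at h

lemma one_sub_norm_sq_of_mem_boxRegion {w z : Cn n} {ε : ℝ} (hw : w ∈ unitBall n)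
    (hε : ε ≤ 1 / 8) (hε0 : 0 < ε) (hz : z ∈ boxRegion w ε) :
    (1 - ‖w‖ ^ 2) / 2 ≤ 1 - ‖z‖ ^ 2 ∧ 1 - ‖z‖ ^ 2 ≤ 2 * (1 - ‖w‖ ^ 2) := by
  have h := one_sub_norm_sq_of_mem_tangentBox hw hε hε0 hz
  rwa [add_sub_cancel] at h

/-- Box regions with nearby centres are nested. -/
lemma boxRegion_subset {w z : Cn n} {ε : ℝ} (hw : w ∈ unitBall n)
    (hε : ε ≤ 1 / 8) (hε0 : 0 < ε) (hz : z ∈ boxRegion w (ε / 8)) :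
    boxRegion z (ε / 8) ⊆ boxRegion w ε := by
  intro u hu
  have hρ := one_sub_norm_sq_pos hw
  have hzw := (one_sub_norm_sq_of_mem_boxRegion hw (by linarith) (by positivity) hz).2
  set ρ := 1 - ‖w‖ ^ 2 with hρd
  have e : u - w = (u - z) + (z - w) := by abel
  have a1 : ‖u - z‖ < ε / 8 * (2 * √ρ) := by
    -- The factor 2 absorbs the comparison 1 - |z|² ≤ 2ρ between the two centres.
    refine lt_of_pow_lt_pow_left₀ 2 (by positivity) (lt_of_lt_of_le hu.1 ?_)
    rw [mul_pow, mul_pow, sq_sqrt hρ.le]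
    gcongr
    linarith
  have a2 : ‖z - w‖ < ε / 8 * √ρ := by
    refine lt_of_pow_lt_pow_left₀ 2 (by positivity) (lt_of_lt_of_le hz.1 ?_)
    rw [mul_pow, sq_sqrt hρ.le]
  constructor
  · rw [e, ← hρd]
    have h1 : ‖(u - z) + (z - w)‖ ≤ ε / 2 * √ρ := by
      refine (norm_add_le _ _).trans ?_
      nlinarith [sqrt_nonneg ρ, mul_nonneg hε0.le (sqrt_nonneg ρ)]
    calc ‖(u - z) + (z - w)‖ ^ 2 ≤ (ε / 2 * √ρ) ^ 2 := by gcongr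
      _ = ε ^ 2 * ρ / 4 := by rw [mul_pow, sq_sqrt hρ.le]; ring
      _ < ε ^ 2 * ρ := by
        have : 0 < ε ^ 2 * ρ := by positivity
        linarith
  · rw [e, ← hρd]
    -- Moving the second argument from w to z costs ⟨u - z, z - w⟩, a product of two vectors of
    -- length O(√ρ), hence again O(ρ).
    have h1 : herm ((u - z) + (z - w)) w = herm (u - z) z - herm (u - z) (z - w) + herm (z - w) w := by
      rw [herm_add_left, herm_sub_right (u - z) z w]; ring
    have h2 : ‖herm (u - z) (z - w)‖ ≤ ε / 8 * (2 * √ρ) * (ε / 8 * √ρ) :=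
      (norm_herm_le _ _).trans (mul_le_mul a1.le a2.le (norm_nonneg _) (by positivity))
    have h3 : ε / 8 * (2 * √ρ) * (ε / 8 * √ρ) = ε * ε / 32 * ρ := by
      have := mul_self_sqrt hρ.le
      linear_combination ε * ε / 32 * this
    have h4 := hu.2
    have h5 := hz.2
    rw [h1]
    have h6 := norm_add_le (herm (u - z) z - herm (u - z) (z - w)) (herm (z - w) w)
    have h7 := norm_sub_le (herm (u - z) z) (herm (u - z) (z - w))
    have h8 : ε / 8 * (1 - ‖z‖ ^ 2) ≤ ε / 8 * (2 * ρ) := by gcongr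
    have h9 : ε * ε / 32 * ρ ≤ ε * 1 / 32 * ρ := by gcongr; linarith
    have h10 : 0 < ε * ρ := by positivity
    linarith

/-- Since |e^l - 1| ≤ 2|l|, a disc of radius comparable to ρ in the radial flow stays in the box.
This radius is what makes each radial derivative cost one factor 1/ρ. -/
lemma exp_smul_mem_boxRegion {w : Cn n} {ε : ℝ} (hw : w ∈ unitBall n) (hε : ε ≤ 1 / 8)
    (hε0 : 0 < ε) {l : ℂ} (hl : ‖l‖ ≤ ε / 4 * (1 - ‖w‖ ^ 2)) :
    Complex.exp l • w ∈ boxRegion w ε := by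
  have hρ := one_sub_norm_sq_pos hw
  have hw1 := (mem_unitBall.1 hw).le
  set ρ := 1 - ‖w‖ ^ 2 with hρd
  have hρ1 : ρ ≤ 1 := by linarith [sq_nonneg ‖w‖]
  have hl1 : ‖l‖ ≤ 1 := hl.trans (by nlinarith)
  have he : ‖Complex.exp l - 1‖ ≤ ε / 2 * ρ := by
    refine (Complex.norm_exp_sub_one_le hl1).trans ?_
    linarith
  have e1 : Complex.exp l • w - w = (Complex.exp l - 1) • w := by rw [sub_smul, one_smul]
  show _ ∈ tangentBox w ε
  rw [e1]
  constructor
  · rw [norm_smul, mul_pow, ← hρd]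
    calc ‖Complex.exp l - 1‖ ^ 2 * ‖w‖ ^ 2 ≤ (ε / 2 * ρ) ^ 2 * 1 ^ 2 := by gcongr
      _ = ε ^ 2 * ρ * (ρ / 4) := by ring
      _ < ε ^ 2 * ρ := mul_lt_of_lt_one_right (by positivity) (by linarith)
  · rw [herm_smul_left, norm_mul, herm_self, Complex.norm_real, norm_of_nonneg (sq_nonneg _),
      ← hρd]
    calc ‖Complex.exp l - 1‖ * ‖w‖ ^ 2 ≤ ε / 2 * ρ * 1 ^ 2 := by gcongr
      _ < ε * ρ := by nlinarith [mul_pos hε0 hρ]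

lemma isOpen_boxRegion (w : Cn n) (ε : ℝ) : IsOpen (boxRegion w ε) :=
  (isOpen_tangentBox w ε).preimage (by fun_prop)

lemma lintegral_tangentBox_add (g : Cn n → ENNReal) (w : Cn n) (ε : ℝ) :
    ∫⁻ u in tangentBox w ε, g (w + u) = ∫⁻ z in boxRegion w ε, g z := by
  have h := (measurePreserving_add_left (volume : Measure (Cn n)) w).setLIntegral_comp_preimage_emb
    (MeasurableEquiv.addLeft w).measurableEmbedding g (boxRegion w ε)
  rw [← h]
  congr 2
  ext u
  simp [boxRegion]

/-- Holomorphic functions are controlled at the centre of a box region by their `L^p` mean. -/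
lemma exists_norm_rpow_le (hn : 1 ≤ n) {p ε : ℝ} (hp : 0 < p) (hε : ε ≤ 1 / 8) (hε0 : 0 < ε) :
    ∃ C : ℝ, 0 < C ∧ ∀ f : Cn n → ℂ, IsHolomorphic f → ∀ w ∈ unitBall n,
      ENNReal.ofReal (‖f w‖ ^ p) ≤ ENNReal.ofReal (C / (1 - ‖w‖ ^ 2) ^ (n + 1)) *
        ∫⁻ z in boxRegion w ε, ENNReal.ofReal (‖f z‖ ^ p) := by
  obtain ⟨c, hc, hvol⟩ := volume_tangentBox_ge hn hε0
  refine ⟨1 / c, by positivity, fun f hf w hw => ?_⟩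
  have hρ := one_sub_norm_sq_pos hw
  have h := norm_rpow_mul_volume_le hf hp (isOpen_tangentBox w ε).measurableSet (w := w)
    (fun ζ hζ l hl => smul_mem_tangentBox hζ hl) (fun ζ hζ => add_mem_unitBall hw hε hε0 hζ)
  rw [lintegral_tangentBox_add (fun z => ENNReal.ofReal (‖f z‖ ^ p))] at h
  have h2 := (mul_le_mul_right (hvol w hw) (ENNReal.ofReal (‖f w‖ ^ p))).trans h
  have hpos : 0 < c * (1 - ‖w‖ ^ 2) ^ (n + 1) := by positivity
  calc ENNReal.ofReal (‖f w‖ ^ p) = ENNReal.ofReal (1 / c / (1 - ‖w‖ ^ 2) ^ (n + 1)) *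
        (ENNReal.ofReal (‖f w‖ ^ p) * ENNReal.ofReal (c * (1 - ‖w‖ ^ 2) ^ (n + 1))) := by
        rw [← ENNReal.ofReal_mul (by positivity), ← ENNReal.ofReal_mul (by positivity)]
        congr 1
        field_simp
    _ ≤ _ := mul_le_mul_right h2 _

/-- The pointwise estimate for iterated radial derivatives by local `L^p` means. -/
lemma exists_norm_radialDerivIter_rpow_le (hn : 1 ≤ n) {p ε : ℝ} (hp : 0 < p) (hε : ε ≤ 1 / 8)
    (hε0 : 0 < ε) (j : ℕ) :
    ∃ C : ℝ, 0 < C ∧ ∀ f : Cn n → ℂ, IsHolomorphic f → ∀ w ∈ unitBall n,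
      ENNReal.ofReal (‖radialDerivIter j f w‖ ^ p) ≤
        ENNReal.ofReal (C / (1 - ‖w‖ ^ 2) ^ (n + 1 + j * p)) *
        ∫⁻ z in boxRegion w ε, ENNReal.ofReal (‖f z‖ ^ p) := by
  obtain ⟨C, hC, h⟩ := exists_norm_rpow_le (n := n) hn hp (by linarith : ε / 8 ≤ 1 / 8)
    (by positivity)
  set κ : ℝ := j.factorial / (ε / 8 / 4) ^ j with hκ
  have hκ0 : 0 < κ := by positivity
  refine ⟨κ ^ p * (C * 2 ^ (n + 1)), by positivity, fun f hf w hw => ?_⟩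
  have hρ := one_sub_norm_sq_pos hw
  set ρ := 1 - ‖w‖ ^ 2 with hρd
  set I := ∫⁻ z in boxRegion w ε, ENNReal.ofReal (‖f z‖ ^ p) with hI
  -- If the local mean is infinite there is nothing to prove, as its coefficient is positive.
  rcases eq_or_ne I ⊤ with hItop | hItop
  · rw [hItop, ENNReal.mul_top]
    · exact le_top
    · simp only [ne_eq, ENNReal.ofReal_eq_zero, not_le]; positivity
  have hmem : ∀ l : ℂ, ‖l‖ ≤ ε / 8 / 4 * ρ → Complex.exp l • w ∈ boxRegion w (ε / 8) :=
    fun l hl => exp_smul_mem_boxRegion hw (by linarith) (by positivity) hl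
  have hmemB : ∀ l : ℂ, ‖l‖ ≤ ε / 8 / 4 * ρ → Complex.exp l • w ∈ unitBall n :=
    fun l hl => mem_unitBall_of_mem_boxRegion hw (by linarith) (by positivity) (hmem l hl)
  set A : ℝ := C * 2 ^ (n + 1) / ρ ^ (n + 1) * I.toReal with hA
  have hA0 : 0 ≤ A := by positivity
  -- Each point z of the flow disc is estimated on its own box of size ε / 8, contained in the box
  -- of w; the factor 2^(n+1) comes from 1 - |z|² ≥ ρ / 2.
  have hfb : ∀ l : ℂ, ‖l‖ ≤ ε / 8 / 4 * ρ → ‖f (Complex.exp l • w)‖ ≤ A ^ (1 / p) := by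
    intro l hl
    have h1 := h f hf _ (hmemB l hl)
    have h2 := (one_sub_norm_sq_of_mem_boxRegion hw (by linarith) (by positivity) (hmem l hl)).1
    set z := Complex.exp l • w
    have h3 : ENNReal.ofReal (‖f z‖ ^ p) ≤ ENNReal.ofReal A := by
      refine h1.trans ?_
      rw [hA, ENNReal.ofReal_mul (by positivity), ENNReal.ofReal_toReal hItop]
      refine mul_le_mul' (ENNReal.ofReal_le_ofReal ?_)
        (lintegral_mono_set (boxRegion_subset hw hε hε0 (hmem l hl)))
      rw [mul_div_assoc, ← div_pow, div_eq_mul_inv, ← inv_pow]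
      refine mul_le_mul_of_nonneg_left (pow_le_pow_left₀ ?_ ?_ _) hC.le
      · exact inv_nonneg.2 (one_sub_norm_sq_pos (hmemB l hl)).le
      · rw [inv_le_comm₀ (one_sub_norm_sq_pos (hmemB l hl)) (by positivity), inv_div]
        exact h2
    rw [ENNReal.ofReal_le_ofReal_iff hA0] at h3
    rw [one_div, ← rpow_le_rpow_iff (norm_nonneg _) (rpow_nonneg hA0 _) hp, rpow_inv_rpow hA0 hp.ne']
    exact h3
  have hder := norm_radialDerivIter_le hf j (by positivity : 0 < ε / 8 / 4 * ρ) hmemB hfb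
  have hder2 : ‖radialDerivIter j f w‖ ≤ κ * A ^ (1 / p) / ρ ^ j := by
    refine hder.trans (le_of_eq ?_)
    rw [hκ, mul_pow]
    field_simp
  have hder3 : ‖radialDerivIter j f w‖ ^ p ≤
      κ ^ p * (C * 2 ^ (n + 1)) / ρ ^ (n + 1 + j * p) * I.toReal := by
    refine (rpow_le_rpow (norm_nonneg _) hder2 hp.le).trans (le_of_eq ?_)
    rw [div_rpow (by positivity) (by positivity), mul_rpow hκ0.le (by positivity), one_div,
      rpow_inv_rpow hA0 hp.ne', hA, rpow_add hρ, ← rpow_natCast ρ j, ← rpow_mul hρ.le,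
      show ((n : ℝ) + 1) = ((n + 1 : ℕ) : ℝ) by push_cast; ring, rpow_natCast]
    field_simp
  refine (ENNReal.ofReal_le_ofReal hder3).trans (le_of_eq ?_)
  rw [ENNReal.ofReal_mul (by positivity), ENNReal.ofReal_toReal hItop]

/-! ### Comparison with the Bergman metric -/

lemma bergmanForm_nonneg {z : Cn n} (hz : z ∈ unitBall n) (u : Cn n) : 0 ≤ bergmanForm z u := by
  have := one_sub_norm_sq_pos hz
  unfold bergmanForm
  positivity

lemma bergmanLength_nonneg (γ : ℝ → Cn n) : 0 ≤ bergmanLength γ :=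
  intervalIntegral.integral_nonneg zero_le_one fun _ _ => sqrt_nonneg _

lemma bddBelow_bergmanLength (z w : Cn n) : BddBelow (bergmanLength '' curvesBetween z w) :=
  ⟨0, by rintro _ ⟨γ, -, rfl⟩; exact bergmanLength_nonneg γ⟩

lemma segment_mem_curvesBetween {z w : Cn n} (hz : z ∈ unitBall n) (hw : w ∈ unitBall n) :
    (fun t : ℝ => z + t • (w - z)) ∈ curvesBetween z w := by
  refine ⟨ContDiff.contDiffOn (by fun_prop), fun t ht => ?_, by simp, by simp⟩
  exact (convex_ball (0 : Cn n) 1).add_smul_sub_mem hz hw ht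

/-- Box regions are contained in Bergman balls. -/
lemma exists_bergmanDist_lt_of_mem_boxRegion {R : ℝ} (hR : 0 < R) :
    ∃ ε : ℝ, 0 < ε ∧ ε ≤ 1 / 8 ∧ ∀ w ∈ unitBall n, ∀ z ∈ boxRegion w ε, bergmanDist w z < R := by
  -- Along the segment from w to z the Bergman form is at most 2ε² + 16ε² ≤ (5ε)², so the length is
  -- at most 5ε ≤ R / 2.
  refine ⟨min (1 / 8) (R / 10), by positivity, min_le_left _ _, fun w hw z hz => ?_⟩
  have hε10 : min (1 / 8) (R / 10) ≤ R / 10 := min_le_right _ _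
  have hε8 : min (1 / 8) (R / 10) ≤ 1 / 8 := min_le_left _ _
  have hε0 : 0 < min (1 / 8) (R / 10) := by positivity
  set ε := min (1 / 8) (R / 10)
  have hzB := mem_unitBall_of_mem_boxRegion hw hε8 hε0 hz
  have hρ := one_sub_norm_sq_pos hw
  have hcurve := segment_mem_curvesBetween hw hzB
  refine lt_of_le_of_lt (csInf_le (bddBelow_bergmanLength w z) ⟨_, hcurve, rfl⟩) ?_
  set u := z - w with hu
  have hbound : ∀ t ∈ Icc (0 : ℝ) 1,
      √(bergmanForm (w + t • u) (derivWithin (fun t : ℝ => w + t • u) (Icc 0 1) t)) ≤ 5 * ε := by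
    intro t ht
    have hder : derivWithin (fun t : ℝ => w + t • u) (Icc 0 1) t = u := by
      have h : HasDerivAt (fun t : ℝ => w + t • u) u t := by
        simpa using ((hasDerivAt_id t).smul_const u).const_add w
      exact h.hasDerivWithinAt.derivWithin (uniqueDiffOn_Icc zero_lt_one t ht)
    have htu : t • u ∈ tangentBox w ε := by
      have h := smul_mem_tangentBox (l := (t : ℂ)) hz
        (by rw [Complex.norm_real, norm_eq_abs, abs_of_nonneg ht.1]; exact ht.2)
      rwa [Complex.coe_smul] at h
    have h1 := (one_sub_norm_sq_of_mem_tangentBox hw hε8 hε0 htu).1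
    have h2 := hz.1
    have h3 := hz.2
    rw [← hu] at h2 h3
    rw [hder]
    set ρ := 1 - ‖w‖ ^ 2
    have h4 : ‖herm u (w + t • u)‖ ≤ 2 * (ε * ρ) := by
      rw [herm_add_right, herm_real_smul_right, herm_self]
      refine (norm_add_le _ _).trans ?_
      rw [norm_mul, Complex.norm_real, Complex.norm_real, norm_eq_abs, abs_of_nonneg ht.1,
        norm_of_nonneg (sq_nonneg _)]
      have h5 : t * ‖u‖ ^ 2 ≤ 1 * (ε ^ 2 * ρ) := by
        gcongr
        exact ht.2
      have h6 : ε ^ 2 * ρ ≤ ε * ρ := by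
        gcongr
        nlinarith
      linarith
    refine sqrt_le_iff.2 ⟨by positivity, ?_⟩
    unfold bergmanForm
    have h7 : ‖u‖ ^ 2 / (1 - ‖w + t • u‖ ^ 2) ≤ ε ^ 2 * ρ / (ρ / 2) := by gcongr
    have h8 : ‖herm u (w + t • u)‖ ^ 2 / (1 - ‖w + t • u‖ ^ 2) ^ 2 ≤
        (2 * (ε * ρ)) ^ 2 / (ρ / 2) ^ 2 := by gcongr
    have h9 : ε ^ 2 * ρ / (ρ / 2) = 2 * ε ^ 2 := by field_simp
    have h10 : (2 * (ε * ρ)) ^ 2 / (ρ / 2) ^ 2 = 16 * ε ^ 2 := by field_simp; norm_num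
    nlinarith [sq_nonneg ε]
  have h := intervalIntegral.norm_integral_le_of_norm_le_const (a := (0 : ℝ)) (b := 1)
    (C := 5 * ε) (f := fun t => √(bergmanForm (w + t • u)
      (derivWithin (fun t : ℝ => w + t • u) (Icc 0 1) t))) fun t ht => by
      rw [norm_of_nonneg (sqrt_nonneg _)]
      rw [uIoc_of_le zero_le_one] at ht
      exact hbound t (Ioc_subset_Icc_self ht)
  rw [sub_zero, abs_one, mul_one] at h
  refine lt_of_le_of_lt ((le_abs_self _).trans h) ?_
  linarith

/-- The fundamental theorem of calculus on [t, 1]. It serves with F the Bergman speed of a curve γ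
ending at a, and with G equal to log (1 - |γ|²), γ and ⟨γ, a⟩ in turn. -/
lemma norm_sub_le_of_norm_deriv_le {E : Type*} [NormedAddCommGroup E] [NormedSpace ℝ E]
    [CompleteSpace E] {G g : ℝ → E} {F : ℝ → ℝ} {c L : ℝ} (hG : ContinuousOn G (Icc 0 1))
    (hder : ∀ t ∈ Ioo (0 : ℝ) 1, HasDerivAt G (g t) t) (hg : ContinuousOn g (Icc 0 1))
    (hF : ContinuousOn F (Icc 0 1)) (hF0 : ∀ t ∈ Icc (0 : ℝ) 1, 0 ≤ F t) (hc : 0 ≤ c)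
    (hgF : ∀ t ∈ Icc (0 : ℝ) 1, ‖g t‖ ≤ c * F t) (hL : ∫ t in (0 : ℝ)..1, F t ≤ L) :
    ∀ t ∈ Icc (0 : ℝ) 1, ‖G t - G 1‖ ≤ c * L := by
  intro t ht
  have hsub : Icc t 1 ⊆ Icc 0 1 := Icc_subset_Icc_left ht.1
  have hFi : IntervalIntegrable F volume 0 1 :=
    ContinuousOn.intervalIntegrable (by rwa [uIcc_of_le zero_le_one])
  have hFt : IntervalIntegrable F volume t 1 :=
    ContinuousOn.intervalIntegrable (by rw [uIcc_of_le ht.2]; exact hF.mono hsub)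
  have h1 := intervalIntegral.integral_eq_sub_of_hasDerivAt_of_le ht.2 (hG.mono hsub)
    (fun x hx => hder x ⟨ht.1.trans_lt hx.1, hx.2⟩)
    (ContinuousOn.intervalIntegrable (by rw [uIcc_of_le ht.2]; exact hg.mono hsub))
  rw [norm_sub_rev, ← h1]
  calc ‖∫ x in t..1, g x‖ ≤ ∫ x in t..1, c * F x :=
        intervalIntegral.norm_integral_le_of_norm_le ht.2
          (ae_of_all _ fun x hx => hgF x (hsub (Ioc_subset_Icc_self hx))) (hFt.const_mul c)
    _ = c * ∫ x in t..1, F x := intervalIntegral.integral_const_mul _ _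
    _ ≤ c * ∫ x in (0 : ℝ)..1, F x := by
      refine mul_le_mul_of_nonneg_left ?_ hc
      refine intervalIntegral.integral_mono_interval ht.1 ht.2 le_rfl ?_ hFi
      exact (ae_restrict_iff' measurableSet_Ioc).2
        (ae_of_all _ fun x hx => hF0 x (Ioc_subset_Icc_self hx))
    _ ≤ c * L := mul_le_mul_of_nonneg_left hL hc

/-- Bergman balls are contained in Carleson-type regions. -/
lemma norm_one_sub_herm_le_of_mem_bergmanBall {R : ℝ} (hR : 0 < R) {a z : Cn n}
    (ha : a ∈ unitBall n) (hz : z ∈ bergmanBall a R) :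
    ‖1 - herm z a‖ ≤ (1 + R * (1 + R) * exp (2 * R)) * (1 - ‖a‖ ^ 2) := by
  obtain ⟨_, ⟨γ, ⟨hγ, hγB, hγ0, hγ1⟩, rfl⟩, hlen⟩ := exists_lt_of_csInf_lt
    (Set.Nonempty.image _ ⟨_, segment_mem_curvesBetween hz.1 ha⟩) hz.2
  have hρ := one_sub_norm_sq_pos ha
  set ρ := 1 - ‖a‖ ^ 2 with hρd
  set γ' := derivWithin γ (Icc 0 1) with hγ'
  set F : ℝ → ℝ := fun t => √(bergmanForm (γ t) (γ' t)) with hF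
  have hL : ∫ t in (0 : ℝ)..1, F t ≤ R := hlen.le
  have hγc : ContinuousOn γ (Icc 0 1) := hγ.continuousOn
  have hγ'c : ContinuousOn γ' (Icc 0 1) :=
    hγ.continuousOn_derivWithin (uniqueDiffOn_Icc zero_lt_one) le_rfl
  have hder : ∀ t ∈ Ioo (0 : ℝ) 1, HasDerivAt γ (γ' t) t := fun t ht =>
    ((hγ.differentiableOn one_ne_zero) t (Ioo_subset_Icc_self ht)).hasDerivWithinAt.hasDerivAt
      (Icc_mem_nhds ht.1 ht.2)
  set φ : ℝ → ℝ := fun t => 1 - ‖γ t‖ ^ 2 with hφ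
  have hφ0 : ∀ t ∈ Icc (0 : ℝ) 1, 0 < φ t := fun t ht => one_sub_norm_sq_pos (hγB ht)
  have hφc : ContinuousOn φ (Icc 0 1) := continuousOn_const.sub (hγc.norm.pow 2)
  have hhc : ContinuousOn (fun t => herm (γ' t) (γ t)) (Icc 0 1) := by
    simp only [herm_eq_inner]
    exact hγc.inner hγ'c
  have hFc : ContinuousOn F (Icc 0 1) := by
    refine ContinuousOn.sqrt (ContinuousOn.add ?_ ?_)
    · exact (hγ'c.norm.pow 2).div hφc fun t ht => (hφ0 t ht).ne'
    · exact (hhc.norm.pow 2).div (hφc.pow 2) fun t ht => (pow_pos (hφ0 t ht) 2).ne'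
  have hF0 : ∀ t ∈ Icc (0 : ℝ) 1, 0 ≤ F t := fun t _ => sqrt_nonneg _
  have hFsq : ∀ t ∈ Icc (0 : ℝ) 1, F t ^ 2 = bergmanForm (γ t) (γ' t) := fun t ht =>
    sq_sqrt (bergmanForm_nonneg (hγB ht) _)
  -- Each of the two terms of the Bergman form is at most F²: one bounds the full velocity by F √φ,
  -- the other its complex radial part by F φ.
  have hFn : ∀ t ∈ Icc (0 : ℝ) 1, ‖γ' t‖ ≤ F t * √(φ t) := by
    intro t ht
    have h0 := hφ0 t ht
    refine le_of_sq_le_sq ?_ (mul_nonneg (hF0 t ht) (sqrt_nonneg _))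
    rw [mul_pow, sq_sqrt h0.le, hFsq t ht, ← div_le_iff₀ h0]
    exact le_add_of_nonneg_right (by positivity)
  have hFh : ∀ t ∈ Icc (0 : ℝ) 1, ‖herm (γ' t) (γ t)‖ ≤ F t * φ t := by
    intro t ht
    have h0 := hφ0 t ht
    refine le_of_sq_le_sq ?_ (mul_nonneg (hF0 t ht) h0.le)
    rw [mul_pow, hFsq t ht, ← div_le_iff₀ (pow_pos h0 2)]
    exact le_add_of_nonneg_left (div_nonneg (sq_nonneg _) h0.le)
  have hφ1 : φ 1 = ρ := by simp only [hφ, hγ1, hρd]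
  -- The logarithmic derivative of φ is at most 2F, so φ ≤ e^(2R) ρ along the whole curve; this
  -- turns the bounds in φ into bounds in ρ.
  have hlog := norm_sub_le_of_norm_deriv_le (G := fun t => log (φ t))
    (g := fun t => -(2 * (herm (γ' t) (γ t)).re) / φ t) (F := F) (c := 2) (L := R)
    (hφc.log fun t ht => (hφ0 t ht).ne')
    (fun t ht => by
      have h1 := ((hder t ht).norm_sq.const_sub 1).log (hφ0 t (Ioo_subset_Icc_self ht)).ne'
      rwa [← re_herm_eq_inner] at h1)
    ((((Complex.continuous_re.comp_continuousOn hhc).const_mul 2).neg).div hφc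
      fun t ht => (hφ0 t ht).ne')
    hFc hF0 zero_le_two
    (fun t ht => by
      have h0 := hφ0 t ht
      rw [norm_div, norm_neg, norm_mul, norm_eq_abs (φ t), abs_of_pos h0, div_le_iff₀ h0]
      have h1 := (Complex.abs_re_le_norm (herm (γ' t) (γ t))).trans (hFh t ht)
      rw [norm_eq_abs, norm_eq_abs, abs_two]
      linarith)
    hL
  have hφle : ∀ t ∈ Icc (0 : ℝ) 1, φ t ≤ exp (2 * R) * ρ := by
    intro t ht
    have h1 := (le_abs_self _).trans (hlog t ht)
    rw [hφ1] at h1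
    have h2 : log (φ t) ≤ 2 * R + log ρ := by linarith
    have h3 := exp_le_exp.2 h2
    rwa [exp_log (hφ0 t ht), exp_add, exp_log hρ] at h3
  have hsq : √(exp (2 * R) * ρ) = exp R * √ρ := by
    rw [sqrt_mul (exp_pos _).le, two_mul, exp_add, sqrt_mul_self (exp_pos R).le]
  have hFn' : ∀ t ∈ Icc (0 : ℝ) 1, ‖γ' t‖ ≤ exp R * √ρ * F t := by
    intro t ht
    refine (hFn t ht).trans ?_
    rw [mul_comm, ← hsq]
    exact mul_le_mul_of_nonneg_right (sqrt_le_sqrt (hφle t ht)) (hF0 t ht)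
  have hdist := norm_sub_le_of_norm_deriv_le (G := γ) (g := γ') (F := F)
    (c := exp R * √ρ) (L := R) hγc hder hγ'c hFc hF0 (by positivity) hFn' hL
  have hherm := norm_sub_le_of_norm_deriv_le (G := fun t => herm (γ t) a)
    (g := fun t => herm (γ' t) a) (F := F) (c := exp (2 * R) * (1 + R) * ρ) (L := R)
    (by simp only [herm_eq_inner]; exact continuousOn_const.inner hγc)
    (fun t ht => by
      have h := (hasDerivAt_const t a).inner ℂ (hder t ht)
      simpa only [herm_eq_inner, inner_zero_left, add_zero] using h)
    (by simp only [herm_eq_inner]; exact continuousOn_const.inner hγ'c)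
    hFc hF0 (by positivity)
    (fun t ht => by
      -- The first term is O(F ρ) by the radial bound; the second is velocity O(F √ρ) times
      -- displacement O(√ρ). The crude bound |γ'| |a| would give only √ρ.
      have h1 : herm (γ' t) a = herm (γ' t) (γ t) - herm (γ' t) (γ t - a) := by
        rw [herm_sub_right]; ring
      rw [h1]
      refine (norm_sub_le _ _).trans ?_
      have h2 : ‖herm (γ' t) (γ t)‖ ≤ F t * (exp (2 * R) * ρ) :=
        (hFh t ht).trans (mul_le_mul_of_nonneg_left (hφle t ht) (hF0 t ht))
      have h3 : ‖herm (γ' t) (γ t - a)‖ ≤ exp R * √ρ * F t * (exp R * √ρ * R) := by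
        refine (norm_herm_le _ _).trans (mul_le_mul (hFn' t ht) ?_ (norm_nonneg _) ?_)
        · rw [← hγ1]; exact hdist t ht
        · have := hF0 t ht
          positivity
      have h4 : exp R * √ρ * F t * (exp R * √ρ * R) = F t * (exp (2 * R) * ρ) * R := by
        rw [two_mul, exp_add]
        have := mul_self_sqrt hρ.le
        linear_combination (exp R * exp R * F t * R) * this
      linarith)
    hL
  have h0 := hherm 0 (left_mem_Icc.2 zero_le_one)
  simp only [hγ0, hγ1] at h0
  have h1 : 1 - herm z a = (ρ : ℂ) - (herm z a - herm a a) := by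
    rw [herm_self, hρd]; push_cast; ring
  rw [h1]
  refine (norm_sub_le _ _).trans ?_
  rw [Complex.norm_real, norm_of_nonneg hρ.le]
  linarith

lemma bergmanBallBounded_of_carlesonBounded (hn : 1 ≤ n) {μ : Measure (Cn n)} {d R : ℝ}
    (hR : 0 < R) (h : CarlesonBounded μ d) : BergmanBallBounded μ d R := by
  obtain ⟨C, hC, h⟩ := h
  set K := 1 + R * (1 + R) * exp (2 * R) with hK
  have hK0 : 0 < K := by positivity
  refine ⟨C * (4 * K) ^ d, by positivity, fun a ha => ?_⟩
  obtain ⟨ζ, hζ, haζ⟩ := exists_unit_direction hn a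
  have hρ := one_sub_norm_sq_pos ha
  -- One factor 2 comes from replacing a by its direction ζ, the other makes the inequality strict.
  have hsub : bergmanBall a R ⊆ carlesonRegion (4 * K * (1 - ‖a‖ ^ 2)) ζ := by
    intro z hz
    refine ⟨hz.1, ?_⟩
    have h1 := norm_one_sub_herm_le_of_mem_bergmanBall hR ha hz
    have h2 := norm_one_sub_herm_direction_le hz.1 ha hζ haζ
    have h3 : 0 < K * (1 - ‖a‖ ^ 2) := by positivity
    rw [← hK] at h1
    linarith
  refine (measure_mono hsub).trans ((h _ (by positivity) ζ (mem_unitSphere.2 hζ)).trans ?_)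
  rw [mul_rpow (by positivity) hρ.le, mul_assoc]

/-! ### The norm as an energy integral -/

lemma minOrder_spec {p : ℝ} (hp : 0 < p) (α : ℝ) : -1 < p * minOrder p α + α := by
  -- Needed because `sInf` of an empty set of naturals would be 0.
  have hne : {N : ℕ | -1 < p * N + α}.Nonempty := by
    obtain ⟨N, hN⟩ := exists_nat_gt ((-1 - α) / p)
    rw [div_lt_iff₀ hp] at hN
    exact ⟨N, by simp only [mem_ofPred_eq]; linarith⟩
  exact Nat.sInf_mem hne

lemma minOrder_le {p α : ℝ} {k : ℕ} (hk : -1 < α + k * p) : minOrder p α ≤ k :=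
  Nat.sInf_le (by simp only [mem_ofPred_eq]; linarith)

lemma weightedVolume_univ_pos (α : ℝ) : 0 < weightedVolume n α univ := by
  rw [weightedVolume, withDensity_apply _ MeasurableSet.univ, Measure.restrict_univ,
    setLIntegral_pos_iff (by fun_prop)]
  have hsub : unitBall n ⊆ (Function.support fun z : Cn n => ENNReal.ofReal ((1 - ‖z‖ ^ 2) ^ α)) ∩
      unitBall n := by
    refine subset_inter (fun z hz => ?_) subset_rfl
    have := one_sub_norm_sq_pos hz
    simp only [Function.mem_support, ne_eq, ENNReal.ofReal_eq_zero, not_le]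
    positivity
  exact lt_of_lt_of_le (isOpen_unitBall.measure_pos _ ⟨0, by simp [mem_unitBall]⟩)
    (measure_mono hsub)

/-- The normalization is a positive finite factor independent of f, so it only affects constants,
and α > -1 and α ≤ -1 can be treated alike from here on. -/
lemma exists_volumeAlpha_eq_smul (hn : 1 ≤ n) (α : ℝ) :
    ∃ c : ENNReal, c ≠ 0 ∧ c ≠ ⊤ ∧ volumeAlpha n α = c • weightedVolume n α := by
  by_cases h : -1 < α
  · refine ⟨(weightedVolume n α univ)⁻¹, ENNReal.inv_ne_zero.2 (weightedVolume_univ_lt_top hn h).ne,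
      ENNReal.inv_ne_top.2 (weightedVolume_univ_pos α).ne', ?_⟩
    rw [volumeAlpha, if_pos h]
  · refine ⟨1, one_ne_zero, ENNReal.one_ne_top, ?_⟩
    rw [volumeAlpha, if_neg h, one_smul]

/-- The integral of `(1 - |z|²)^{pN + α} |R^N f|^p` over the ball. -/
def bergmanEnergy (p α : ℝ) (f : Cn n → ℂ) : ENNReal :=
  ∫⁻ z in unitBall n, ENNReal.ofReal ((1 - ‖z‖ ^ 2) ^ (p * minOrder p α + α) *
    ‖radialDerivIter (minOrder p α) f z‖ ^ p)

lemma exists_eLpNorm_weightedDeriv (hn : 1 ≤ n) {p : ℝ} (hp : 0 < p) (α : ℝ) :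
    ∃ c : ENNReal, c ≠ 0 ∧ c ≠ ⊤ ∧ ∀ f : Cn n → ℂ,
      eLpNorm (weightedDeriv p α f) (ENNReal.ofReal p) (volumeAlpha n α) =
        (c * bergmanEnergy p α f) ^ (1 / p) := by
  obtain ⟨c, hc0, hct, hc⟩ := exists_volumeAlpha_eq_smul hn α
  refine ⟨c, hc0, hct, fun f => ?_⟩
  rw [eLpNorm_eq_lintegral_rpow_enorm_toReal (by simpa using hp) ENNReal.ofReal_ne_top,
    ENNReal.toReal_ofReal hp.le, hc, lintegral_smul_measure, lintegral_weightedVolume, smul_eq_mul]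
  congr 2
  refine setLIntegral_congr_fun measurableSet_unitBall fun z hz => ?_
  have hρ := one_sub_norm_sq_pos hz
  simp only [weightedDeriv]
  set ρ := 1 - ‖z‖ ^ 2
  rw [← ofReal_norm, ENNReal.ofReal_rpow_of_nonneg (norm_nonneg _) hp.le,
    ← ENNReal.ofReal_mul (by positivity), norm_mul, Complex.norm_real,
    norm_of_nonneg (by positivity), mul_rpow (by positivity) (norm_nonneg _), ← mul_assoc,
    ← rpow_natCast, ← rpow_mul hρ.le, ← rpow_add hρ]
  congr 3
  ring_nf

lemma aestronglyMeasurable_weightedDeriv (hn : 1 ≤ n) (p α : ℝ) {f : Cn n → ℂ}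
    (hf : IsHolomorphic f) : AEStronglyMeasurable (weightedDeriv p α f) (volumeAlpha n α) := by
  have h1 : ContinuousOn (weightedDeriv p α f) (unitBall n) := by
    refine ContinuousOn.mul (Continuous.continuousOn ?_)
      (DifferentiableOn.continuousOn (hf.radialDerivIter _))
    fun_prop
  obtain ⟨c, -, -, hc⟩ := exists_volumeAlpha_eq_smul hn α
  rw [hc]
  exact ((h1.aestronglyMeasurable measurableSet_unitBall).mono_ac
    (withDensity_absolutelyContinuous _ _)).smul_measure c

/-- Membership in the space and the norm in terms of the energy integral. -/
lemma exists_bergmanNorm_eq (hn : 1 ≤ n) {p : ℝ} (hp : 0 < p) (α : ℝ) :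
    ∃ c : ENNReal, c ≠ 0 ∧ c ≠ ⊤ ∧
      (∀ f : Cn n → ℂ, f ∈ bergmanSpace n p α ↔ IsHolomorphic f ∧ bergmanEnergy p α f < ⊤) ∧
      ∀ f : Cn n → ℂ, bergmanNorm p α f =
        ‖f 0‖ + ((c * bergmanEnergy p α f) ^ (1 / p)).toReal := by
  obtain ⟨c, hc0, hct, hc⟩ := exists_eLpNorm_weightedDeriv hn hp α
  refine ⟨c, hc0, hct, fun f => ?_, fun f => by rw [bergmanNorm, hc]⟩
  refine and_congr_right fun hf => ?_
  rw [MemLp, and_iff_right (aestronglyMeasurable_weightedDeriv hn p α hf), hc,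
    ENNReal.rpow_lt_top_iff_of_pos (by positivity)]
  refine ⟨fun h => ?_, fun h => ENNReal.mul_lt_top hct.lt_top h⟩
  by_contra! h2
  rw [top_le_iff.1 h2, ENNReal.mul_top hc0] at h
  exact lt_irrefl _ h

/-! ### Test functions -/

/-- The numerators of the iterated radial derivatives of `(1 - ⟨w, a⟩)⁻ᵇ`. -/
def kernelNumerator (b : ℕ) : ℕ → Polynomial ℂ
  | 0 => 1
  | j + 1 => Polynomial.C ((b + j : ℕ) : ℂ) * Polynomial.X * kernelNumerator b j +
      Polynomial.X * (1 - Polynomial.X) * Polynomial.derivative (kernelNumerator b j)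

/-- At 1 the derivative term of the recursion drops out, leaving the product b (b + 1) ⋯ (b + j -
1). Hence the radial derivatives of the test function have their full size near its singularity. -/
lemma kernelNumerator_eval_one_ne_zero {b : ℕ} (hb : 1 ≤ b) (j : ℕ) :
    (kernelNumerator b j).eval 1 ≠ 0 := by
  induction j with
  | zero => simp [kernelNumerator]
  | succ j ih =>
    have : ((b : ℂ) + j) ≠ 0 := by
      have : ((b + j : ℕ) : ℂ) ≠ 0 := Nat.cast_ne_zero.2 (by omega)
      exact_mod_cast this
    simp [kernelNumerator, ih, this]

/-- The test function `(1 - ⟨w, a⟩)⁻ᵇ`. -/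
def kernelPower (b : ℕ) (a w : Cn n) : ℂ := ((1 - herm w a) ^ b)⁻¹

lemma hasFDerivAt_herm_left (a w : Cn n) :
    HasFDerivAt (fun w : Cn n => herm w a) (innerSL ℂ a : Cn n →L[ℂ] ℂ) w := by
  have h : (fun w : Cn n => herm w a) = fun w => (innerSL ℂ a : Cn n →L[ℂ] ℂ) w := by
    funext w
    rw [herm_eq_inner, innerSL_apply_apply]
  rw [h]
  exact (innerSL ℂ a : Cn n →L[ℂ] ℂ).hasFDerivAt

lemma radialDeriv_comp_herm {g : ℂ → ℂ} {g' : ℂ} {a w : Cn n}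
    (hg : HasDerivAt g g' (herm w a)) :
    radialDeriv (fun w => g (herm w a)) w = herm w a * g' := by
  have h : HasFDerivAt (fun w => g (herm w a)) (g' • (innerSL ℂ a : Cn n →L[ℂ] ℂ)) w :=
    hg.comp_hasFDerivAt w (hasFDerivAt_herm_left a w)
  rw [radialDeriv_eq_fderiv, h.fderiv]
  simp [herm_eq_inner, mul_comm]

lemma one_sub_herm_ne_zero {w a : Cn n} (hw : w ∈ unitBall n) (ha : a ∈ unitBall n) :
    1 - herm w a ≠ 0 := norm_pos_iff.1 (norm_one_sub_herm_pos hw ha)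

lemma isHolomorphic_kernelPower (b : ℕ) {a : Cn n} (ha : a ∈ unitBall n) :
    IsHolomorphic (kernelPower b a) := by
  intro w hw
  refine DifferentiableAt.differentiableWithinAt ?_
  have h := (hasFDerivAt_herm_left a w).differentiableAt
  have h2 : DifferentiableAt ℂ (fun w => (1 - herm w a) ^ b) w :=
    ((differentiableAt_const (1 : ℂ)).sub h).pow b
  have h3 := h2.fun_inv (pow_ne_zero _ (one_sub_herm_ne_zero hw ha))
  exact h3

/-- On functions g(⟨w, a⟩) the operator R acts as x g'(x), and the quotient rule reproduces the
recursion for the numerators. -/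
lemma radialDerivIter_kernelPower (b j : ℕ) {a : Cn n} (ha : a ∈ unitBall n) :
    EqOn (radialDerivIter j (kernelPower b a))
      (fun w => (kernelNumerator b j).eval (herm w a) / (1 - herm w a) ^ (b + j)) (unitBall n) := by
  induction j with
  | zero => intro w _; simp [radialDerivIter, kernelNumerator, kernelPower]
  | succ j ih =>
    intro w hw
    rw [radialDerivIter_succ, radialDeriv_congr ih hw]
    have hne := one_sub_herm_ne_zero hw ha
    have h1 : HasDerivAt (fun x : ℂ => (1 - x) ^ (b + j))
        (((b + j : ℕ) : ℂ) * (1 - herm w a) ^ (b + j - 1) * (-1)) (herm w a) :=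
      ((hasDerivAt_id (herm w a)).const_sub 1).pow (b + j)
    have h2 := ((kernelNumerator b j).hasDerivAt (herm w a)).div h1 (pow_ne_zero _ hne)
    rw [radialDeriv_comp_herm (g := fun x => (kernelNumerator b j).eval x / (1 - x) ^ (b + j)) h2]
    simp only [kernelNumerator, Polynomial.eval_add, Polynomial.eval_mul, Polynomial.eval_C,
      Polynomial.eval_X, Polynomial.eval_sub, Polynomial.eval_one]
    -- The case b + j = 0 is separate because the exponent b + j - 1 is a truncated subtraction.
    rcases Nat.eq_zero_or_pos (b + j) with h0 | h0
    · rw [show b + (j + 1) = b + j + 1 by ring, h0]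
      field_simp
      simp only [Nat.cast_zero, zero_mul, mul_zero, neg_zero, sub_zero, zero_add]
      ring
    · obtain ⟨m, hm⟩ : ∃ m, b + j = m + 1 := ⟨b + j - 1, by omega⟩
      rw [show b + (j + 1) = b + j + 1 by ring, hm, Nat.add_sub_cancel]
      field_simp
      ring

/-! ### Necessity: from the embedding to the Carleson condition -/

/-- `R^k` maps `A^p_α` boundedly to `L^q(μ)`. -/
def CarlesonEmbedding (μ : Measure (Cn n)) (p q α : ℝ) (k : ℕ) : Prop :=
  ∃ C : ℝ, 0 < C ∧ ∀ f ∈ bergmanSpace n p α,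
    ∫⁻ w in unitBall n, ENNReal.ofReal (‖radialDerivIter k f w‖ ^ q) ∂μ ≤
      ENNReal.ofReal (C * bergmanNorm p α f ^ q)

lemma mem_bergmanSpace_of_fixed (hn : 1 ≤ n) {p α : ℝ} (hp : 0 < p) {f : Cn n → ℂ}
    (hf : IsHolomorphic f) (hfix : radialDerivIter (minOrder p α) f = f)
    (hb : ∀ z ∈ unitBall n, ‖f z‖ ≤ 1) : f ∈ bergmanSpace n p α := by
  obtain ⟨c, -, -, hmem, -⟩ := exists_bergmanNorm_eq hn hp α
  refine (hmem f).2 ⟨hf, ?_⟩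
  refine lt_of_le_of_lt ?_ (weightedVolume_univ_lt_top hn (minOrder_spec hp α))
  rw [weightedVolume, withDensity_apply _ MeasurableSet.univ, Measure.restrict_univ]
  refine setLIntegral_mono' measurableSet_unitBall fun z hz => ENNReal.ofReal_le_ofReal ?_
  rw [hfix]
  have := one_sub_norm_sq_pos hz
  exact mul_le_of_le_one_right (by positivity) (rpow_le_one (norm_nonneg _) (hb z hz) hp.le)

lemma radialDeriv_coordinate (j : Fin n) :
    radialDeriv (fun z : Cn n => z j) = fun z : Cn n => z j := by
  funext z
  rw [radialDeriv_eq_fderiv]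
  have h : HasFDerivAt (fun z : Cn n => z j) (EuclideanSpace.proj j : Cn n →L[ℂ] ℂ) z :=
    (EuclideanSpace.proj j : Cn n →L[ℂ] ℂ).hasFDerivAt
  rw [h.fderiv]
  rfl

lemma radialDerivIter_coordinate (k : ℕ) (j : Fin n) :
    radialDerivIter k (fun z : Cn n => z j) = fun z : Cn n => z j :=
  Function.iterate_fixed (radialDeriv_coordinate j) k

/-- For k = 0 test on the constant 1. For k ≥ 1 constants are annihilated, but R fixes the
coordinates; testing on them bounds μ away from the origin, and the hypothesis at 0 supplies the
rest. -/
lemma measure_unitBall_lt_top_of_embedding (hn : 1 ≤ n) {p q α : ℝ} (hp : 0 < p) (hq : 0 < q)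
    {k : ℕ} (hk : -1 < α + k * p) {μ : Measure (Cn n)}
    (hμ : 1 ≤ k → ∃ ε : ℝ, 0 < ε ∧ μ (ball 0 ε) < ⊤) (h : CarlesonEmbedding μ p q α k) :
    μ (unitBall n) < ⊤ := by
  obtain ⟨C, hC, h⟩ := h
  rcases Nat.eq_zero_or_pos k with rfl | hk0
  · have hN : minOrder p α = 0 := Nat.le_zero.1 (minOrder_le hk)
    have h1 := h (fun _ => 1) (mem_bergmanSpace_of_fixed hn hp (differentiableOn_const 1)
      (by rw [hN]; rfl) fun z _ => by simp)
    have h2 := const_mul_measure_le_setLIntegral (μ := μ) measurableSet_unitBall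
      (subset_refl (unitBall n)) (c := 1)
      (g := fun w => ENNReal.ofReal (‖radialDerivIter 0 (fun _ => (1 : ℂ)) w‖ ^ q))
      fun w _ => by simp [radialDerivIter]
    rw [one_mul] at h2
    exact (h2.trans h1).trans_lt ENNReal.ofReal_lt_top
  · obtain ⟨ε, hε, hμε⟩ := hμ hk0
    have hn0 : (0 : ℝ) < n := by exact_mod_cast hn
    have hn1 : (1 : ℝ) ≤ n := by exact_mod_cast hn
    -- If all coordinates are below δ, then |w|² < n δ² = ε² / n ≤ ε².
    set δ := ε / n
    have hδ : 0 < δ := by positivity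
    let S : Fin n → Set (Cn n) := fun j => unitBall n ∩ {w | δ ≤ ‖w j‖}
    have hS : ∀ j, μ (S j) < ⊤ := by
      intro j
      have hSm : MeasurableSet (S j) :=
        measurableSet_unitBall.inter (measurableSet_le measurable_const (by fun_prop))
      have hhol : IsHolomorphic fun z : Cn n => z j :=
        (EuclideanSpace.proj (𝕜 := ℂ) j).differentiable.differentiableOn
      have h1 := h _ (mem_bergmanSpace_of_fixed hn hp hhol (radialDerivIter_coordinate _ j)
        fun z hz => (PiLp.norm_apply_le z j).trans (mem_unitBall.1 hz).le)
      rw [radialDerivIter_coordinate] at h1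
      have h2 := const_mul_measure_le_setLIntegral (μ := μ) hSm inter_subset_left
        (c := ENNReal.ofReal (δ ^ q)) (g := fun w => ENNReal.ofReal (‖w j‖ ^ q))
        fun w hw => ENNReal.ofReal_le_ofReal (rpow_le_rpow hδ.le hw.2 hq.le)
      have h3 := (h2.trans h1).trans_lt ENNReal.ofReal_lt_top
      by_contra! h4
      rw [top_le_iff.1 h4, ENNReal.mul_top (by simpa using rpow_pos_of_pos hδ q)] at h3
      exact lt_irrefl _ h3
    have hcov : unitBall n ⊆ ball 0 ε ∪ ⋃ j, S j := by
      intro w hw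
      by_cases hj : ∃ j, δ ≤ ‖w j‖
      · obtain ⟨j, hj⟩ := hj
        exact Or.inr (mem_iUnion.2 ⟨j, hw, hj⟩)
      · push Not at hj
        refine Or.inl (mem_ball_zero_iff.2 (lt_of_pow_lt_pow_left₀ 2 hε.le ?_))
        rw [EuclideanSpace.norm_sq_eq]
        have : Nonempty (Fin n) := ⟨⟨0, hn⟩⟩
        calc ∑ j, ‖w j‖ ^ 2 < ∑ _j : Fin n, δ ^ 2 :=
              Finset.sum_lt_sum_of_nonempty Finset.univ_nonempty
                fun j _ => pow_lt_pow_left₀ (hj j) (norm_nonneg _) two_ne_zero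
          _ = ε ^ 2 / n := by
            simp only [Finset.sum_const, Finset.card_univ, Fintype.card_fin, nsmul_eq_mul, δ]
            field_simp
          _ ≤ ε ^ 2 := div_le_self (sq_nonneg _) hn1
    refine (measure_mono hcov).trans_lt ((measure_union_le _ _).trans_lt ?_)
    refine ENNReal.add_lt_top.2 ⟨hμε, ?_⟩
    refine (measure_iUnion_le _).trans_lt ?_
    rw [tsum_fintype]
    exact ENNReal.sum_lt_top.2 fun j _ => hS j

/-- The norms of the test functions. -/
lemma exists_bergmanNorm_kernelPower_le (hn : 1 ≤ n) {p α : ℝ} (hp : 0 < p) {b : ℕ}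
    (hb : (n + 1 + α) / p < b) :
    ∃ K : ℝ, 0 < K ∧ ∀ a ∈ unitBall n, kernelPower b a ∈ bergmanSpace n p α ∧
      bergmanNorm p α (kernelPower b a) ≤ K * (1 - ‖a‖ ^ 2) ^ ((n + 1 + α) / p - b) := by
  obtain ⟨c, -, hct, hmem, hnorm⟩ := exists_bergmanNorm_eq (n := n) hn hp α
  set N := minOrder p α with hN
  -- The lower bound on b is exactly the convergence condition of the Forelli–Rudin estimate with σ
  -- = p (b + N).
  have hσ : (n : ℝ) + 1 + (p * N + α) < p * (b + N) := by
    rw [div_lt_iff₀ hp] at hb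
    linarith
  obtain ⟨C, hC, hFR⟩ := exists_lintegral_kernel_le hn (minOrder_spec hp α) hσ
  obtain ⟨M, hM⟩ := (isCompact_closedBall (0 : ℂ) 1).exists_bound_of_continuousOn
    (kernelNumerator b N).continuous.continuousOn
  have hM0 : 0 ≤ M := (norm_nonneg _).trans (hM 0 (by simp))
  have henergy : ∀ a ∈ unitBall n, bergmanEnergy p α (kernelPower b a) ≤
      ENNReal.ofReal (M ^ p * (C * (1 - ‖a‖ ^ 2) ^ (n + 1 + (p * N + α) - p * (b + N)))) := by
    intro a ha
    rw [ENNReal.ofReal_mul (by positivity)]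
    refine le_trans ?_ (mul_le_mul_right (hFR a ha) _)
    rw [← lintegral_const_mul' _ _ ENNReal.ofReal_ne_top]
    refine setLIntegral_mono' measurableSet_unitBall fun w hw => ?_
    have hρ := one_sub_norm_sq_pos hw
    have hx := norm_one_sub_herm_pos hw ha
    rw [← ENNReal.ofReal_mul (by positivity), radialDerivIter_kernelPower b _ ha hw]
    refine ENNReal.ofReal_le_ofReal ?_
    have h1 : ‖(kernelNumerator b N).eval (herm w a)‖ ≤ M := by
      refine hM _ (mem_closedBall_zero_iff.2 ((norm_herm_le w a).trans ?_))
      exact mul_le_one₀ (mem_unitBall.1 hw).le (norm_nonneg _) (mem_unitBall.1 ha).le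
    have e : (‖1 - herm w a‖ ^ (b + N)) ^ p = ‖1 - herm w a‖ ^ (p * (b + N)) := by
      rw [← rpow_natCast, ← rpow_mul hx.le]
      congr 1; push_cast; ring
    rw [← hN, norm_div, norm_pow, div_rpow (norm_nonneg _) (by positivity), e]
    calc (1 - ‖w‖ ^ 2) ^ (p * N + α) * (‖(kernelNumerator b N).eval (herm w a)‖ ^ p /
          ‖1 - herm w a‖ ^ (p * (b + N)))
        ≤ (1 - ‖w‖ ^ 2) ^ (p * N + α) * (M ^ p / ‖1 - herm w a‖ ^ (p * (b + N))) := by gcongr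
      _ = _ := by ring
  refine ⟨1 + (c.toReal * (M ^ p * C)) ^ (1 / p), by positivity, fun a ha => ?_⟩
  have hρ := one_sub_norm_sq_pos ha
  have hE := henergy a ha
  refine ⟨(hmem _).2 ⟨isHolomorphic_kernelPower b ha, hE.trans_lt ENNReal.ofReal_lt_top⟩, ?_⟩
  set ρ := 1 - ‖a‖ ^ 2 with hρd
  have hρ1 : ρ ≤ 1 := by linarith [sq_nonneg ‖a‖]
  -- The term |f(0)| = 1 is absorbed because ρ ≤ 1 is raised to a negative power.
  have h0 : ‖kernelPower b a 0‖ ≤ ρ ^ ((n + 1 + α) / p - b) := by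
    have : kernelPower b a 0 = 1 := by simp [kernelPower, herm]
    rw [this, norm_one]
    exact one_le_rpow_of_pos_of_le_one_of_nonpos hρ hρ1 (by linarith)
  have h1 : ((c * bergmanEnergy p α (kernelPower b a)) ^ (1 / p)).toReal ≤
      (c.toReal * (M ^ p * C)) ^ (1 / p) * ρ ^ ((n + 1 + α) / p - b) := by
    refine ENNReal.toReal_le_of_le_ofReal (by positivity) ?_
    calc (c * bergmanEnergy p α (kernelPower b a)) ^ (1 / p)
        ≤ (ENNReal.ofReal (c.toReal * (M ^ p * (C * ρ ^ (n + 1 + (p * N + α) - p * (b + N)))))) ^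
          (1 / p) := by
          refine ENNReal.rpow_le_rpow ?_ (by positivity)
          rw [ENNReal.ofReal_mul ENNReal.toReal_nonneg, ENNReal.ofReal_toReal hct]
          exact mul_le_mul_right hE _
      _ = _ := by
        rw [ENNReal.ofReal_rpow_of_nonneg (by positivity) (by positivity),
          show c.toReal * (M ^ p * (C * ρ ^ (n + 1 + (p * N + α) - p * (b + N)))) =
            c.toReal * (M ^ p * C) * ρ ^ (n + 1 + (p * N + α) - p * (b + N)) by ring,
          mul_rpow (by positivity) (by positivity), ← rpow_mul hρ.le]
        congr 3
        field_simp
        ring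
  rw [hnorm, add_mul, one_mul]
  exact add_le_add h0 h1

lemma exists_kernelNumerator_ge {b : ℕ} (hb : 1 ≤ b) (k : ℕ) :
    ∃ c δ : ℝ, 0 < c ∧ 0 < δ ∧ ∀ x : ℂ, ‖1 - x‖ < δ → c ≤ ‖(kernelNumerator b k).eval x‖ := by
  have h0 : 0 < ‖(kernelNumerator b k).eval 1‖ :=
    norm_pos_iff.2 (kernelNumerator_eval_one_ne_zero hb k)
  have hcont : ContinuousAt (fun x => ‖(kernelNumerator b k).eval x‖) 1 :=
    (kernelNumerator b k).continuous.norm.continuousAt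
  have hev := hcont.eventually_const_lt (half_lt_self h0)
  obtain ⟨δ, hδ, h⟩ := Metric.eventually_nhds_iff.1 hev
  refine ⟨_, δ, half_pos h0, hδ, fun x hx => (h ?_).le⟩
  rwa [dist_eq_norm, norm_sub_rev]

lemma carlesonBounded_of_embedding (hn : 1 ≤ n) {p q α : ℝ} (hp : 0 < p) (hq : 0 < q)
    {k : ℕ} (hk : -1 < α + k * p) {μ : Measure (Cn n)}
    (hμ : 1 ≤ k → ∃ ε : ℝ, 0 < ε ∧ μ (ball 0 ε) < ⊤) (h : CarlesonEmbedding μ p q α k) :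
    CarlesonBounded μ ((n + 1 + α + k * p) * q / p) := by
  have hfin := measure_unitBall_lt_top_of_embedding hn hp hq hk hμ h
  obtain ⟨C, hC, h⟩ := h
  obtain ⟨b, hb1, hb⟩ : ∃ b : ℕ, 1 ≤ b ∧ (n + 1 + α) / p < b := by
    obtain ⟨b, hb⟩ := exists_nat_gt ((n + 1 + α) / p)
    exact ⟨b + 1, by omega, hb.trans (by push_cast; linarith)⟩
  obtain ⟨K, hK, hnorm⟩ := exists_bergmanNorm_kernelPower_le hn hp hb
  obtain ⟨c, δ, hc, hδ, hge⟩ := exists_kernelNumerator_ge hb1 k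
  set d := (n + 1 + α + k * p) * q / p with hd
  have hd0 : 0 < d := by
    have : (0 : ℝ) ≤ n := n.cast_nonneg
    have : 0 < n + 1 + α + k * p := by linarith
    positivity
  set e := (n + 1 + α) / p - b with he
  have he0 : e < 0 := by linarith
  -- The bound 1/2 keeps (1 - r) ζ in the ball; δ/2 gives |1 - ⟨w, a⟩| < 2r < δ on Q_r(ζ), where the
  -- numerator is at least c.
  set r₀ := min (1 / 2) (δ / 2) with hr₀
  have hr₀0 : 0 < r₀ := by positivity
  set V := (μ (unitBall n)).toReal
  set A := C * K ^ q * (2 ^ (b + k) / c) ^ q with hA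
  refine ⟨A + V / r₀ ^ d, by positivity, fun r hr ζ hζ => ?_⟩
  rw [mem_unitSphere] at hζ
  rcases lt_or_ge r r₀ with hrr | hrr
  · have hr1 : r < 1 / 2 := hrr.trans_le (min_le_left _ _)
    have hrδ : r < δ / 2 := hrr.trans_le (min_le_right _ _)
    have haB : (1 - r) • ζ ∈ unitBall n := by
      rw [mem_unitBall, norm_radial (by linarith) hζ]; linarith
    obtain ⟨hmem, hle⟩ := hnorm _ haB
    have h1 := h _ hmem
    rw [norm_radial (by linarith) hζ] at hle
    set a := (1 - r) • ζ
    have hρr : r ≤ 1 - (1 - r) ^ 2 := by nlinarith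
    have hle2 : bergmanNorm p α (kernelPower b a) ≤ K * r ^ e := hle.trans
      (mul_le_mul_of_nonneg_left (rpow_le_rpow_of_nonpos hr hρr he0.le) hK.le)
    have hn0 : 0 ≤ bergmanNorm p α (kernelPower b a) :=
      add_nonneg (norm_nonneg _) ENNReal.toReal_nonneg
    have h2 : ENNReal.ofReal ((c / (2 * r) ^ (b + k)) ^ q) * μ (carlesonRegion r ζ) ≤
        ENNReal.ofReal (C * (K * r ^ e) ^ q) := by
      refine (const_mul_measure_le_setLIntegral (isOpen_carlesonRegion r ζ).measurableSet
        (carlesonRegion_subset r ζ) fun w hw => ?_).trans (h1.trans (ENNReal.ofReal_le_ofReal ?_))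
      · refine ENNReal.ofReal_le_ofReal (rpow_le_rpow (by positivity) ?_ hq.le)
        rw [radialDerivIter_kernelPower b k haB hw.1, norm_div, norm_pow]
        have h3 := norm_one_sub_herm_radial_lt hr hζ hw
        have h4 := norm_one_sub_herm_pos hw.1 haB
        have h5 := hge (herm w a) (by linarith)
        gcongr
      · gcongr
    have hpos : 0 < (c / (2 * r) ^ (b + k)) ^ q := by positivity
    rw [mul_comm, ← ENNReal.le_div_iff_mul_le (Or.inl (by simpa using hpos))
      (Or.inl ENNReal.ofReal_ne_top), ← ENNReal.ofReal_div_of_pos hpos] at h2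
    refine h2.trans (ENNReal.ofReal_le_ofReal ?_)
    -- The auxiliary exponent b cancels: (b + k) q + ((n + 1 + α)/p - b) q = d.
    have hexp : r ^ d = (r ^ (b + k)) ^ q * (r ^ e) ^ q := by
      rw [← rpow_natCast, ← rpow_mul hr.le, ← rpow_mul hr.le, ← rpow_add hr]
      congr 1
      rw [hd, he]
      push_cast
      field_simp
      ring
    have heq : C * (K * r ^ e) ^ q / (c / (2 * r) ^ (b + k)) ^ q = A * r ^ d := by
      rw [hexp, hA, mul_pow, div_rpow hc.le (by positivity), div_rpow (by positivity) hc.le,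
        mul_rpow (by positivity) (by positivity), mul_rpow (by positivity) (by positivity)]
      field_simp
    rw [heq]
    exact mul_le_mul_of_nonneg_right (le_add_of_nonneg_right (by positivity)) (by positivity)
  · refine (measure_mono (carlesonRegion_subset r ζ)).trans ?_
    rw [← ENNReal.ofReal_toReal hfin.ne]
    refine ENNReal.ofReal_le_ofReal ?_
    calc V = V / r₀ ^ d * r₀ ^ d := by field_simp
      _ ≤ (A + V / r₀ ^ d) * r ^ d := by
        gcongr
        exact le_add_of_nonneg_left (by positivity)

/-! ### Sufficiency: from Bergman balls to the embedding -/

lemma isOpen_setOf_mem_boxRegion (ε : ℝ) :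
    IsOpen {x : Cn n × Cn n | x.2 ∈ boxRegion x.1 ε} := by
  have h1 : IsOpen {x : Cn n × Cn n | ‖x.2 - x.1‖ ^ 2 < ε ^ 2 * (1 - ‖x.1‖ ^ 2)} :=
    isOpen_lt (by fun_prop) (by fun_prop)
  have h2 : IsOpen {x : Cn n × Cn n | ‖herm (x.2 - x.1) x.1‖ < ε * (1 - ‖x.1‖ ^ 2)} :=
    isOpen_lt (by fun_prop) (by fun_prop)
  exact h1.inter h2

lemma isOpen_centres_boxRegion (z : Cn n) (ε : ℝ) : IsOpen {w : Cn n | z ∈ boxRegion w ε} := by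
  have h1 : IsOpen {w : Cn n | ‖z - w‖ ^ 2 < ε ^ 2 * (1 - ‖w‖ ^ 2)} :=
    isOpen_lt (by fun_prop) (by fun_prop)
  have h2 : IsOpen {w : Cn n | ‖herm (z - w) w‖ < ε * (1 - ‖w‖ ^ 2)} :=
    isOpen_lt (by fun_prop) (by fun_prop)
  exact h1.inter h2

lemma self_mem_boxRegion {w : Cn n} (hw : w ∈ unitBall n) {ε : ℝ} (hε : 0 < ε) :
    w ∈ boxRegion w ε := by
  have hρ := one_sub_norm_sq_pos hw
  show _ ∈ tangentBox w ε
  rw [sub_self]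
  constructor
  · rw [norm_zero, zero_pow two_ne_zero]; positivity
  · rw [herm_eq_inner, inner_zero_right, norm_zero]; positivity

/-- A measure which is locally finite in the ball is `σ`-finite there. -/
lemma sigmaFinite_restrict_unitBall {μ : Measure (Cn n)}
    (h : ∀ a ∈ unitBall n, ∃ U ∈ 𝓝 a, μ U < ⊤) : SigmaFinite (μ.restrict (unitBall n)) := by
  let K : ℕ → Set (Cn n) := fun i => closedBall 0 (1 - 1 / ((i : ℝ) + 1))
  have hK : ∀ i, K i ⊆ unitBall n := fun i =>
    closedBall_subset_ball (sub_lt_self 1 (by positivity))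
  have hKμ : ∀ i, μ (K i) < ⊤ := fun i =>
    (isCompact_closedBall _ _).measure_lt_top_of_nhdsWithin fun a ha => by
      obtain ⟨U, hU, hUμ⟩ := h a (hK i ha)
      exact ⟨U, mem_nhdsWithin_of_mem_nhds hU, hUμ⟩
  -- The complement of the ball is added only so that the sets cover the whole space; the restricted
  -- measure ignores it.
  refine ⟨⟨⟨fun i => K i ∪ (unitBall n)ᶜ, fun _ => trivial, fun i => ?_, ?_⟩⟩⟩
  · rw [Measure.restrict_apply' measurableSet_unitBall, union_inter_distrib_right,
      compl_inter_self, union_empty]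
    exact (measure_mono inter_subset_left).trans_lt (hKμ i)
  · refine eq_univ_of_forall fun z => mem_iUnion.2 ?_
    by_cases hz : z ∈ unitBall n
    · obtain ⟨i, hi⟩ := exists_nat_one_div_lt (sub_pos.2 (mem_unitBall.1 hz))
      exact ⟨i, Or.inl (mem_closedBall_zero_iff.2 (by linarith))⟩
    · exact ⟨0, Or.inr hz⟩

/-- The measures of box regions, averaged against `μ`. -/
lemma lintegral_mul_measure_boxRegion_le {μ ν : Measure (Cn n)} [SFinite ν]
    {d ε A : ℝ} (hd : 0 < d) (hε8 : ε ≤ 1 / 8) (hε0 : 0 < ε)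
    (hloc : ∀ a ∈ unitBall n, ∃ U ∈ 𝓝 a, μ U < ⊤) (hν : ν (unitBall n)ᶜ = 0)
    (hμ : ∀ z ∈ unitBall n, μ (unitBall n ∩ {w | z ∈ boxRegion w ε}) ≤
      ENNReal.ofReal (A * (1 - ‖z‖ ^ 2) ^ d)) :
    ∫⁻ w in unitBall n, ENNReal.ofReal (1 / (1 - ‖w‖ ^ 2) ^ d) * ν (boxRegion w ε) ∂μ ≤
      ENNReal.ofReal (2 ^ d * A) * ν univ := by
  -- The exchange of integrals needs μ to be σ-finite on the ball, which follows from the local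
  -- bound rather than from any assumption on μ.
  have := sigmaFinite_restrict_unitBall hloc
  let H : Cn n → Cn n → ENNReal := fun w z =>
    {x : Cn n × Cn n | x.2 ∈ boxRegion x.1 ε}.indicator
      (fun x => ENNReal.ofReal (1 / (1 - ‖x.1‖ ^ 2) ^ d)) (w, z)
  have hHm : Measurable fun x : Cn n × Cn n => H x.1 x.2 := by
    refine Measurable.indicator ?_ (isOpen_setOf_mem_boxRegion ε).measurableSet
    fun_prop
  calc ∫⁻ w in unitBall n, ENNReal.ofReal (1 / (1 - ‖w‖ ^ 2) ^ d) * ν (boxRegion w ε) ∂μ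
      = ∫⁻ w in unitBall n, ∫⁻ z, H w z ∂ν ∂μ := by
        refine lintegral_congr fun w => ?_
        rw [← setLIntegral_const, ← lintegral_indicator (isOpen_boxRegion w ε).measurableSet]
        rfl
    _ = ∫⁻ z, ∫⁻ w in unitBall n, H w z ∂μ ∂ν := lintegral_lintegral_swap hHm.aemeasurable
    _ ≤ ∫⁻ _, ENNReal.ofReal (2 ^ d * A) ∂ν := by
      have hae : ∀ᵐ z ∂ν, z ∈ unitBall n := hν
      refine lintegral_mono_ae ?_
      filter_upwards [hae] with z hz
      have hρ := one_sub_norm_sq_pos hz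
      set S := unitBall n ∩ {w | z ∈ boxRegion w ε}
      have hpt : ∀ w ∈ unitBall n, H w z ≤
          S.indicator (fun _ => ENNReal.ofReal (2 ^ d / (1 - ‖z‖ ^ 2) ^ d)) w := by
        intro w hw
        by_cases hzw : z ∈ boxRegion w ε
        · have hwρ := one_sub_norm_sq_pos hw
          have h1 := (one_sub_norm_sq_of_mem_boxRegion hw hε8 hε0 hzw).2
          rw [indicator_of_mem (show w ∈ S from ⟨hw, hzw⟩),
            show H w z = ENNReal.ofReal (1 / (1 - ‖w‖ ^ 2) ^ d) from
              indicator_of_mem (show (w, z) ∈ {x : Cn n × Cn n | x.2 ∈ boxRegion x.1 ε} from hzw) _]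
          refine ENNReal.ofReal_le_ofReal ?_
          rw [← div_rpow zero_le_two hρ.le, one_div, ← inv_rpow hwρ.le]
          refine rpow_le_rpow (inv_nonneg.2 hwρ.le) ?_ hd.le
          rw [inv_le_comm₀ hwρ (by positivity), inv_div]
          linarith
        · rw [show H w z = 0 from indicator_of_notMem
            (show (w, z) ∉ {x : Cn n × Cn n | x.2 ∈ boxRegion x.1 ε} from hzw) _]
          exact zero_le
      have hSm : MeasurableSet S :=
        (isOpen_unitBall.inter (isOpen_centres_boxRegion z ε)).measurableSet
      calc ∫⁻ w in unitBall n, H w z ∂μ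
          ≤ ∫⁻ w in unitBall n, S.indicator
              (fun _ => ENNReal.ofReal (2 ^ d / (1 - ‖z‖ ^ 2) ^ d)) w ∂μ :=
            setLIntegral_mono' measurableSet_unitBall hpt
        _ ≤ ∫⁻ w, S.indicator (fun _ => ENNReal.ofReal (2 ^ d / (1 - ‖z‖ ^ 2) ^ d)) w ∂μ :=
            setLIntegral_le_lintegral _ _
        _ = ENNReal.ofReal (2 ^ d / (1 - ‖z‖ ^ 2) ^ d) * μ S := by
            rw [lintegral_indicator hSm, setLIntegral_const]
        _ ≤ ENNReal.ofReal (2 ^ d / (1 - ‖z‖ ^ 2) ^ d) *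
              ENNReal.ofReal (A * (1 - ‖z‖ ^ 2) ^ d) := mul_le_mul_right (hμ z hz) _
        _ = ENNReal.ofReal (2 ^ d * A) := by
            rw [← ENNReal.ofReal_mul (by positivity)]
            congr 1
            field_simp
    _ = ENNReal.ofReal (2 ^ d * A) * ν univ := lintegral_const _

/-- The density of the energy integral, as a measure. -/
def energyMeasure (p α : ℝ) (f : Cn n → ℂ) : Measure (Cn n) :=
  (volume.restrict (unitBall n)).withDensity fun z =>
    ENNReal.ofReal ((1 - ‖z‖ ^ 2) ^ (p * minOrder p α + α) *
      ‖radialDerivIter (minOrder p α) f z‖ ^ p)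

instance (p α : ℝ) (f : Cn n → ℂ) : SFinite (energyMeasure p α f) := by
  unfold energyMeasure; infer_instance

lemma energyMeasure_univ (p α : ℝ) (f : Cn n → ℂ) :
    energyMeasure p α f univ = bergmanEnergy p α f := by
  rw [energyMeasure, withDensity_apply _ MeasurableSet.univ, Measure.restrict_univ, bergmanEnergy]

lemma energyMeasure_compl (p α : ℝ) (f : Cn n → ℂ) :
    energyMeasure p α f (unitBall n)ᶜ = 0 := by
  rw [energyMeasure, withDensity_apply _ measurableSet_unitBall.compl,
    Measure.restrict_restrict measurableSet_unitBall.compl, compl_inter_self,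
    Measure.restrict_empty, lintegral_zero_measure]

/-- The pointwise estimate of `R^k f` by the local energy. -/
lemma exists_norm_radialDerivIter_rpow_le_energyMeasure (hn : 1 ≤ n) {p α ε : ℝ} (hp : 0 < p)
    (hε8 : ε ≤ 1 / 8) (hε0 : 0 < ε) {k : ℕ} (hk : -1 < α + k * p) :
    ∃ C : ℝ, 0 < C ∧ ∀ f : Cn n → ℂ, IsHolomorphic f → ∀ w ∈ unitBall n,
      ENNReal.ofReal (‖radialDerivIter k f w‖ ^ p) ≤
        ENNReal.ofReal (C / (1 - ‖w‖ ^ 2) ^ (n + 1 + α + k * p)) *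
          energyMeasure p α f (boxRegion w ε) := by
  set N := minOrder p α with hN
  -- Minimality of N gives N ≤ k, so R^k f = R^j (R^N f), and the local estimate applies to R^N f.
  obtain ⟨j, hj⟩ : ∃ j, k = j + N := ⟨k - N, by have := minOrder_le hk; omega⟩
  obtain ⟨C, hC, h⟩ := exists_norm_radialDerivIter_rpow_le hn hp hε8 hε0 j
  set t := p * N + α with ht
  refine ⟨C * 2 ^ |t|, by positivity, fun f hf w hw => ?_⟩
  have hρ := one_sub_norm_sq_pos hw
  have h1 := h _ (hf.radialDerivIter N) w hw
  rw [← radialDerivIter_add, ← hj] at h1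
  refine h1.trans ?_
  set ρ := 1 - ‖w‖ ^ 2
  have hsub : boxRegion w ε ⊆ unitBall n := fun z hz =>
    mem_unitBall_of_mem_boxRegion hw hε8 hε0 hz
  have hbm := (isOpen_boxRegion w ε).measurableSet
  -- On the box 1 - |z|² lies between ρ/2 and 2ρ, so inserting the weight of exponent t costs at
  -- most 2^|t|, whatever the sign of t.
  have h2 : ∫⁻ z in boxRegion w ε, ENNReal.ofReal (‖radialDerivIter N f z‖ ^ p) ≤
      ENNReal.ofReal (2 ^ |t| / ρ ^ t) * energyMeasure p α f (boxRegion w ε) := by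
    rw [energyMeasure, withDensity_apply _ hbm, Measure.restrict_restrict hbm,
      inter_eq_left.2 hsub, ← lintegral_const_mul' _ _ ENNReal.ofReal_ne_top]
    refine setLIntegral_mono' hbm fun z hz => ?_
    have hz1 := one_sub_norm_sq_of_mem_boxRegion hw hε8 hε0 hz
    have hzρ := one_sub_norm_sq_pos (hsub hz)
    rw [← ENNReal.ofReal_mul (by positivity)]
    refine ENNReal.ofReal_le_ofReal ?_
    rw [← mul_assoc]
    refine le_mul_of_one_le_left (by positivity) ?_
    rw [← hN, ← ht, div_mul_eq_mul_div, mul_div_assoc, ← div_rpow hzρ.le hρ.le]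
    set x := (1 - ‖z‖ ^ 2) / ρ with hx
    have hx0 : 0 < x := by positivity
    have hx1 : 1 / 2 ≤ x := by rw [hx, le_div_iff₀ hρ]; linarith
    have hx2 : x ≤ 2 := by rw [hx, div_le_iff₀ hρ]; linarith
    rcases le_total 0 t with ht0 | ht0
    · rw [abs_of_nonneg ht0, ← mul_rpow zero_le_two hx0.le]
      exact one_le_rpow (by linarith) ht0
    · rw [abs_of_nonpos ht0, show x ^ t = x⁻¹ ^ (-t) by rw [inv_rpow hx0.le, rpow_neg hx0.le, inv_inv],
        ← mul_rpow zero_le_two (inv_nonneg.2 hx0.le)]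
      refine one_le_rpow ?_ (by linarith)
      rw [← div_eq_mul_inv, one_le_div hx0]
      exact hx2
  refine (mul_le_mul_right h2 _).trans (le_of_eq ?_)
  rw [← mul_assoc, ← ENNReal.ofReal_mul (by positivity)]
  congr 2
  have e : ρ ^ ((n : ℝ) + 1 + α + k * p) = ρ ^ ((n : ℝ) + 1 + j * p) * ρ ^ t := by
    rw [← rpow_add hρ, hj, ht]
    congr 1; push_cast; ring
  rw [e]
  field_simp

lemma embedding_of_bergmanBallBounded (hn : 1 ≤ n) {p q α R : ℝ} (hp : 0 < p) (hpq : p ≤ q)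
    (hR : 0 < R) {k : ℕ} (hk : -1 < α + k * p) {μ : Measure (Cn n)}
    (h : BergmanBallBounded μ ((n + 1 + α + k * p) * q / p) R) :
    CarlesonEmbedding μ p q α k := by
  obtain ⟨A, hA, h⟩ := h
  have hq : 0 < q := hp.trans_le hpq
  set s := (n + 1 + α + k * p) with hs
  have hs0 : 0 < s := by
    have : (0 : ℝ) ≤ n := n.cast_nonneg
    linarith
  set d := s * q / p with hd
  have hd0 : 0 < d := by positivity
  obtain ⟨ε, hε0, hε8, hdist⟩ := exists_bergmanDist_lt_of_mem_boxRegion (n := n) hR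
  obtain ⟨B, hB, hpt⟩ := exists_norm_radialDerivIter_rpow_le_energyMeasure hn hp hε8 hε0 hk
  obtain ⟨c, hc0, hct, hmem, hnorm⟩ := exists_bergmanNorm_eq (n := n) hn hp α
  -- Membership in boxes is not symmetric, but z in the box of w forces β(w, z) < R, so these
  -- centres lie in D(z, R).
  have hμ : ∀ z ∈ unitBall n, μ (unitBall n ∩ {w | z ∈ boxRegion w ε}) ≤
      ENNReal.ofReal (A * (1 - ‖z‖ ^ 2) ^ d) := fun z hz =>
    (measure_mono (show _ ⊆ bergmanBall z R from
      fun w hw => ⟨hw.1, hdist w hw.1 z hw.2⟩)).trans (h z hz)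
  have hloc : ∀ a ∈ unitBall n, ∃ U ∈ 𝓝 a, μ U < ⊤ := by
    intro a ha
    have hmem : a ∈ unitBall n ∩ {w | a ∈ boxRegion w ε} := by
      refine mem_inter ha ?_
      rw [mem_ofPred_eq]
      exact self_mem_boxRegion ha hε0
    exact ⟨unitBall n ∩ {w | a ∈ boxRegion w ε},
      (isOpen_unitBall.inter (isOpen_centres_boxRegion a ε)).mem_nhds hmem,
      (hμ a ha).trans_lt ENNReal.ofReal_lt_top⟩
  have hqp : 1 ≤ q / p := (one_le_div hp).2 hpq
  have hc0' : 0 < c.toReal := ENNReal.toReal_pos hc0 hct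
  refine ⟨B ^ (q / p) * (2 ^ d * A) * (1 / c.toReal) ^ (q / p), by positivity, fun f hf => ?_⟩
  obtain ⟨hfh, hfe⟩ := (hmem f).1 hf
  set ν := energyMeasure p α f with hν
  have hνu : ν univ = bergmanEnergy p α f := energyMeasure_univ p α f
  have hpt2 : ∀ w ∈ unitBall n, ENNReal.ofReal (‖radialDerivIter k f w‖ ^ q) ≤
      ENNReal.ofReal (B ^ (q / p)) * ν univ ^ (q / p - 1) *
        (ENNReal.ofReal (1 / (1 - ‖w‖ ^ 2) ^ d) * ν (boxRegion w ε)) := by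
    intro w hw
    have hρ := one_sub_norm_sq_pos hw
    have e1 : ENNReal.ofReal (‖radialDerivIter k f w‖ ^ q) =
        ENNReal.ofReal (‖radialDerivIter k f w‖ ^ p) ^ (q / p) := by
      rw [ENNReal.ofReal_rpow_of_nonneg (by positivity) (by positivity), ← rpow_mul (norm_nonneg _),
        mul_div_cancel₀ _ hp.ne']
    have e2 : ENNReal.ofReal (B / (1 - ‖w‖ ^ 2) ^ s) ^ (q / p) =
        ENNReal.ofReal (B ^ (q / p)) * ENNReal.ofReal (1 / (1 - ‖w‖ ^ 2) ^ d) := by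
      rw [ENNReal.ofReal_rpow_of_nonneg (by positivity) (by positivity),
        ← ENNReal.ofReal_mul (by positivity), div_rpow hB.le (by positivity), ← rpow_mul hρ.le,
        hd, mul_div_assoc s q p, mul_one_div]
    -- This is where p ≤ q enters: one factor stays local and linear in ν, ready for Tonelli, and
    -- the surplus power is bounded by the total energy.
    have e3 : ν (boxRegion w ε) ^ (q / p) ≤ ν univ ^ (q / p - 1) * ν (boxRegion w ε) := by
      calc ν (boxRegion w ε) ^ (q / p) = ν (boxRegion w ε) ^ ((q / p - 1) + 1) := by ring_nf
        _ = ν (boxRegion w ε) ^ (q / p - 1) * ν (boxRegion w ε) := by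
          rw [ENNReal.rpow_add_of_nonneg _ _ (by linarith) zero_le_one, ENNReal.rpow_one]
        _ ≤ ν univ ^ (q / p - 1) * ν (boxRegion w ε) := by
          exact mul_le_mul_left (ENNReal.rpow_le_rpow (measure_mono (subset_univ _))
            (sub_nonneg.2 hqp)) _
    rw [e1]
    calc ENNReal.ofReal (‖radialDerivIter k f w‖ ^ p) ^ (q / p)
        ≤ (ENNReal.ofReal (B / (1 - ‖w‖ ^ 2) ^ s) * ν (boxRegion w ε)) ^ (q / p) :=
          ENNReal.rpow_le_rpow (hpt f hfh w hw) (by positivity)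
      _ = ENNReal.ofReal (B ^ (q / p)) * ENNReal.ofReal (1 / (1 - ‖w‖ ^ 2) ^ d) *
            ν (boxRegion w ε) ^ (q / p) := by
          rw [ENNReal.mul_rpow_of_nonneg _ _ (by positivity), e2]
      _ ≤ ENNReal.ofReal (B ^ (q / p)) * ENNReal.ofReal (1 / (1 - ‖w‖ ^ 2) ^ d) *
            (ν univ ^ (q / p - 1) * ν (boxRegion w ε)) := mul_le_mul_right e3 _
      _ = _ := by ring
  have hνt : ν univ ≠ ⊤ := by rw [hνu]; exact hfe.ne
  have hcoef : ENNReal.ofReal (B ^ (q / p)) * ν univ ^ (q / p - 1) ≠ ⊤ :=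
    ENNReal.mul_ne_top ENNReal.ofReal_ne_top (ENNReal.rpow_ne_top_of_nonneg (by linarith) hνt)
  set E := (ν univ).toReal with hE
  have hn1 : (c.toReal * E) ^ (1 / p) ≤ bergmanNorm p α f := by
    rw [hnorm, ← ENNReal.toReal_rpow, ENNReal.toReal_mul, ← hνu]
    exact le_add_of_nonneg_left (norm_nonneg _)
  have hE2 : E ^ (q / p) ≤ (1 / c.toReal) ^ (q / p) * bergmanNorm p α f ^ q := by
    have h3 := rpow_le_rpow (by positivity) hn1 hq.le
    rw [← rpow_mul (by positivity), one_div_mul_eq_div,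
      mul_rpow hc0'.le ENNReal.toReal_nonneg] at h3
    calc E ^ (q / p) = (1 / c.toReal) ^ (q / p) * (c.toReal ^ (q / p) * E ^ (q / p)) := by
          rw [← mul_assoc, ← mul_rpow (by positivity) hc0'.le, one_div_mul_cancel hc0'.ne',
            one_rpow, one_mul]
      _ ≤ _ := mul_le_mul_of_nonneg_left h3 (by positivity)
  calc ∫⁻ w in unitBall n, ENNReal.ofReal (‖radialDerivIter k f w‖ ^ q) ∂μ
      ≤ ∫⁻ w in unitBall n, ENNReal.ofReal (B ^ (q / p)) * ν univ ^ (q / p - 1) *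
        (ENNReal.ofReal (1 / (1 - ‖w‖ ^ 2) ^ d) * ν (boxRegion w ε)) ∂μ :=
        setLIntegral_mono' measurableSet_unitBall hpt2
    _ = ENNReal.ofReal (B ^ (q / p)) * ν univ ^ (q / p - 1) *
        ∫⁻ w in unitBall n, ENNReal.ofReal (1 / (1 - ‖w‖ ^ 2) ^ d) * ν (boxRegion w ε) ∂μ :=
        lintegral_const_mul' _ _ hcoef
    _ ≤ ENNReal.ofReal (B ^ (q / p)) * ν univ ^ (q / p - 1) *
        (ENNReal.ofReal (2 ^ d * A) * ν univ) :=
        mul_le_mul_right (lintegral_mul_measure_boxRegion_le hd0 hε8 hε0 hloc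
          (energyMeasure_compl p α f) hμ) _
    _ = ENNReal.ofReal (B ^ (q / p)) * ENNReal.ofReal (2 ^ d * A) * ν univ ^ (q / p) := by
        have e : ν univ ^ (q / p) = ν univ ^ (q / p - 1) * ν univ := by
          conv_lhs => rw [show q / p = (q / p - 1) + 1 by ring]
          rw [ENNReal.rpow_add_of_nonneg _ _ (by linarith) zero_le_one, ENNReal.rpow_one]
        rw [e]
        ring
    _ = ENNReal.ofReal (B ^ (q / p) * (2 ^ d * A) * E ^ (q / p)) := by
        rw [← ENNReal.ofReal_toReal hνt, ENNReal.ofReal_rpow_of_nonneg ENNReal.toReal_nonneg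
          (by positivity), ← ENNReal.ofReal_mul (by positivity),
          ← ENNReal.ofReal_mul (by positivity)]
    _ ≤ _ := by
        refine ENNReal.ofReal_le_ofReal ?_
        rw [mul_assoc _ ((1 / c.toReal) ^ (q / p))]
        exact mul_le_mul_of_nonneg_left hE2 (by positivity)

end

end BergmanCarleson

/-! ### The equivalence -/

theorem mainTheorem8 (n : ℕ) (hn : 1 ≤ n) (p q α : ℝ) (hp : 0 < p) (hpq : p ≤ q)
    (k : ℕ) (hk : -1 < α + k * p)
    (μ : MeasureTheory.Measure (BergmanCarleson.Cn n))
    (hμ : 1 ≤ k → ∃ ε : ℝ, 0 < ε ∧ μ (Metric.ball 0 ε) < ⊤)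
    (d : ℝ) (hd : d = (n + 1 + α + k * p) * q / p) :
    List.TFAE [
      ∃ C : ℝ, 0 < C ∧ ∀ f ∈ BergmanCarleson.bergmanSpace n p α,
        ∫⁻ w in BergmanCarleson.unitBall n,
            ENNReal.ofReal (‖BergmanCarleson.radialDerivIter k f w‖ ^ q) ∂μ
          ≤ ENNReal.ofReal (C * BergmanCarleson.bergmanNorm p α f ^ q),
      ∀ s : ℝ, 0 < s → BergmanCarleson.BerezinBounded μ d s,
      ∃ s : ℝ, 0 < s ∧ BergmanCarleson.BerezinBounded μ d s,
      ∃ C : ℝ, 0 < C ∧ ∀ r : ℝ, 0 < r → ∀ ζ ∈ BergmanCarleson.unitSphere n,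
        μ (BergmanCarleson.carlesonRegion r ζ) ≤ ENNReal.ofReal (C * r ^ d),
      ∀ R : ℝ, 0 < R → BergmanCarleson.BergmanBallBounded μ d R,
      ∃ R : ℝ, 0 < R ∧ BergmanCarleson.BergmanBallBounded μ d R] := by
  have hq : 0 < q := hp.trans_le hpq
  have hd0 : 0 < d := by
    have h1 : (0 : ℝ) ≤ n := n.cast_nonneg
    have h2 : 0 < n + 1 + α + k * p := by linarith
    rw [hd]
    positivity
  tfae_have 1 → 4 := fun h => by
    rw [hd]
    exact BergmanCarleson.carlesonBounded_of_embedding hn hp hq hk hμ h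
  tfae_have 4 → 2 := fun h s hs =>
    BergmanCarleson.berezinBounded_of_carlesonBounded hn hd0 hs h
  tfae_have 2 → 3 := fun h => ⟨1, one_pos, h 1 one_pos⟩
  tfae_have 3 → 4 := fun ⟨s, hs, h⟩ =>
    BergmanCarleson.carlesonBounded_of_berezinBounded hd0 hs h
  tfae_have 4 → 5 := fun h R hR =>
    BergmanCarleson.bergmanBallBounded_of_carlesonBounded hn hR h
  tfae_have 5 → 6 := fun h => ⟨1, one_pos, h 1 one_pos⟩
  tfae_have 6 → 1 := fun ⟨R, hR, h⟩ => by
    rw [hd] at h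
    exact BergmanCarleson.embedding_of_bergmanBallBounded hn hp hpq hR hk h
  tfae_finish
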